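/- Let $k$ be a field and let $\mathcal C$ be a semisimple pointed tensor category over $k$: a $k$-linear abelian rigid monoidal category with bilinear (hence biexact) tensor product and $\operatorname{End}(\mathbf 1)=k$, with finite-dimensional Hom spaces, in which every object is a finite direct sum of simple objects and every simple object is invertible. Let $\hat{\mathcal C}$ be the cocompletion (ind-completion) of $\mathcal C$, with the tensor product extended cocontinuously in each variable. Let $C$ be a coalgebra object in $\hat{\mathcal C}$; comodules and bicomodules over $C$ are taken in $\hat{\mathcal C}$. Simple comodules have underlying object in $\mathcal C$. For a right comodule $V$ with underlying object in $\mathcal C$, let $V^*$ denote its right dual, which is a left comodule. For a left comodule $W$ and a right comodule $V$, let $W\boxtimes V$ denote $W\otimes V$ with the bicomodule structure whose left coaction comes from $W$ and whose right coaction comes from $V$. For $S\in\hat{\mathcal C}$ and a right comodule $V$, $S\otimes V$ is a right comodule with coaction $\mathrm{id}_S\otimes a_V$. Assume: (C1) if $L$ is a simple right $C$-comodule and $S$ is a simple object of $\mathcal C$ with $L\cong S\otimes L$ as comodules, then $S\cong\mathbf 1$; (C2) if $L,L'$ are simple right $C$-comodules then $L^*\boxtimes L'$ is a simple bicomodule,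 and every simple bicomodule is isomorphic to one of this form. Let $\{L_\alpha\}_\alpha$ be a system of representatives of the simple right comodules modulo the relation $L\sim S\otimes L$ ($S$ a simple object of $\mathcal C$): each $L_\alpha$ is a simple right comodule, $L_\alpha\cong S\otimes L_\beta$ with $S$ simple implies $\alpha=\beta$, and every simple right comodule is isomorphic to $S\otimes L_\alpha$ for some $\alpha$ and some simple $S$. For each $\alpha$ let $L_\alpha\to I(L_\alpha)$ be an injective envelope, that is, a monomorphism into an injective right comodule inducing an isomorphism of socles. Then there is an isomorphism of right comodules $$C\;\cong\;\bigoplus_\alpha L_\alpha^*\otimes I(L_\alpha),$$ where $L_\alpha^*$ is regarded as an object of $\mathcal C$ (its comodule structure is not used) and the direct sum is the coproduct in the category of right comodules. -/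

import Mathlib

open CategoryTheory MonoidalCategory Limits

universe v₁ v₂ u₁ u₂ w

/-! ## The setting -/

/-- `𝒞` is a semisimple pointed tensor category over the field `k`. The `k`-linear abelian structure,
the `k`-bilinear tensor product and the duals are carried by the instance arguments; biexactness of
`⊗` is automatic, since tensoring with a rigid object has adjoints on both sides. -/
structure IsSemisimplePointedTensorCategory (k : Type*) [Field k] (𝒞 : Type*) [Category* 𝒞]
    [Abelian 𝒞] [Linear k 𝒞] [MonoidalCategory 𝒞] [MonoidalPreadditive 𝒞]
    [MonoidalLinear k 𝒞] [RigidCategory 𝒞] : Prop where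
  /-- Hom spaces are finite-dimensional. -/
  finite_hom (X Y : 𝒞) : FiniteDimensional k (X ⟶ Y)
  /-- Semisimple, with all objects of finite length: every object is a finite direct sum of
  simple objects. -/
  semisimple (X : 𝒞) : ∃ (n : ℕ) (S : Fin n → 𝒞), (∀ i, Simple (S i)) ∧ Nonempty (X ≅ ∐ S)
  /-- `End(𝟙) = k`. -/
  end_unit : Function.Bijective (fun c : k => c • 𝟙 (𝟙_ 𝒞))
  /-- Pointed: every simple object is invertible. -/
  invertible (S : 𝒞) : Simple S → ∃ T : 𝒞, Nonempty (S ⊗ T ≅ 𝟙_ 𝒞) ∧ Nonempty (T ⊗ S ≅ 𝟙_ 𝒞)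

/-- The monoidal functor `ι : 𝒞 ⥤ D` exhibits `D` as the cocompletion (ind-completion) of `𝒞`, with
the tensor product of `D` being the extension of that of `𝒞` which is cocontinuous in each
variable. -/
structure IsTensorCocompletion {𝒞 : Type u₁} [Category.{v₁} 𝒞] [MonoidalCategory 𝒞]
    {D : Type u₂} [Category.{v₂} D] [MonoidalCategory D] (ι : 𝒞 ⥤ D) [ι.Monoidal] : Prop where
  /-- `D` is the category of ind-objects of `𝒞`, and `ι` is the canonical embedding. -/
  equivalence_ind : ∃ e : D ≌ Ind 𝒞, Nonempty (ι ⋙ e.functor ≅ Ind.yoneda)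
  cocontinuous_tensorLeft (X : D) : PreservesColimitsOfSize.{v₁, v₁} (tensorLeft X)
  cocontinuous_tensorRight (X : D) : PreservesColimitsOfSize.{v₁, v₁} (tensorRight X)

/-! ## Duals -/

section Duals

variable {D : Type u₂} [Category.{v₂} D] [MonoidalCategory D]

/-- The morphism `Y ⟶ C ⊗ Y` obtained from `a : V ⟶ V ⊗ C` when `Y` is a right dual of `V`:
`Y ⟶ Y ⊗ V ⊗ Y ⟶ Y ⊗ V ⊗ C ⊗ Y ⟶ C ⊗ Y`, by coevaluation, `a` and evaluation. -/
def dualMate {V C : D} (Y : D) [ExactPairing V Y] (a : V ⟶ V ⊗ C) : Y ⟶ C ⊗ Y :=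
  (ρ_ Y).inv ≫ Y ◁ η_ V Y ≫ Y ◁ a ▷ Y ≫ Y ◁ (α_ V C Y).hom ≫
    (α_ Y V (C ⊗ Y)).inv ≫ ε_ V Y ▷ (C ⊗ Y) ≫ (λ_ (C ⊗ Y)).hom

theorem dualMate_naturality {V C C' : D} (Y : D) [ExactPairing V Y] (a : V ⟶ V ⊗ C) (f : C ⟶ C') :
    dualMate Y (a ≫ V ◁ f) = dualMate Y a ≫ f ▷ Y := by
  simp only [dualMate]
  calc _ = (ρ_ Y).inv ≫ Y ◁ η_ V Y ⊗≫ Y ◁ a ▷ Y ⊗≫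
      ((Y ⊗ V) ◁ (f ▷ Y) ≫ ε_ V Y ▷ (C' ⊗ Y)) ≫ (λ_ (C' ⊗ Y)).hom := by monoidal
    _ = _ := by rw [whisker_exchange]; monoidal

theorem dualMate_rightUnitor_inv {V : D} (Y : D) [ExactPairing V Y] :
    dualMate Y (ρ_ V).inv = (λ_ Y).inv := by
  simp only [dualMate]
  calc _ = 𝟙 _ ⊗≫ (Y ◁ η_ V Y ⊗≫ ε_ V Y ▷ Y) ⊗≫ 𝟙 _ := by monoidal
    _ = _ := by rw [ExactPairing.coevaluation_evaluation'']; monoidal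

theorem dualMate_comp {V C E : D} (Y : D) [ExactPairing V Y] (f : V ⟶ V ⊗ C) (g : V ⟶ V ⊗ E) :
    dualMate Y f ≫ C ◁ dualMate Y g = dualMate Y (g ≫ f ▷ E ≫ (α_ V C E).hom) ≫ (α_ C E Y).hom := by
  simp only [dualMate]
  calc
    _ = 𝟙 _ ⊗≫ Y ◁ η_ V Y ⊗≫ Y ◁ f ▷ Y ⊗≫
        (ε_ V Y ▷ (C ⊗ Y ⊗ 𝟙_ D) ≫ (𝟙_ D) ◁ (C ◁ Y ◁ η_ V Y)) ⊗≫
        C ◁ Y ◁ g ▷ Y ⊗≫ C ◁ ε_ V Y ▷ (E ⊗ Y) ⊗≫ 𝟙 _ := by monoidal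
    _ = 𝟙 _ ⊗≫ Y ◁ η_ V Y ⊗≫ Y ◁ f ▷ Y ⊗≫
        (Y ⊗ V) ◁ (C ◁ Y ◁ η_ V Y) ⊗≫
        (ε_ V Y ▷ (C ⊗ Y ⊗ V ⊗ Y) ≫ (𝟙_ D) ◁ (C ◁ Y ◁ g ▷ Y)) ⊗≫
        C ◁ ε_ V Y ▷ (E ⊗ Y) ⊗≫ 𝟙 _ := by
      rw [← whisker_exchange]; monoidal
    _ = 𝟙 _ ⊗≫ Y ◁ η_ V Y ⊗≫ Y ◁ f ▷ Y ⊗≫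
        (Y ⊗ V) ◁ (C ◁ Y ◁ η_ V Y) ⊗≫
        (Y ⊗ V) ◁ (C ◁ Y ◁ g ▷ Y) ⊗≫
        (ε_ V Y ▷ (C ⊗ (Y ⊗ V) ⊗ E ⊗ Y) ≫
          (𝟙_ D) ◁ (C ◁ ε_ V Y ▷ (E ⊗ Y))) ⊗≫ 𝟙 _ := by
      rw [← whisker_exchange]; monoidal
    _ = 𝟙 _ ⊗≫ Y ◁ η_ V Y ⊗≫
        Y ◁ (f ▷ (Y ⊗ 𝟙_ D) ≫ (V ⊗ C) ◁ Y ◁ η_ V Y) ⊗≫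
        Y ◁ V ◁ C ◁ Y ◁ g ▷ Y ⊗≫
        Y ◁ V ◁ C ◁ ε_ V Y ▷ (E ⊗ Y) ⊗≫
        ε_ V Y ▷ (C ⊗ E ⊗ Y) ⊗≫ 𝟙 _ := by
      rw [← whisker_exchange]; monoidal
    _ = 𝟙 _ ⊗≫ Y ◁ η_ V Y ⊗≫
        Y ◁ V ◁ Y ◁ η_ V Y ⊗≫
        Y ◁ (f ▷ (Y ⊗ V ⊗ Y) ≫ (V ⊗ C) ◁ (Y ◁ g ▷ Y)) ⊗≫
        Y ◁ V ◁ C ◁ ε_ V Y ▷ (E ⊗ Y) ⊗≫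
        ε_ V Y ▷ (C ⊗ E ⊗ Y) ⊗≫ 𝟙 _ := by
      rw [← whisker_exchange]; monoidal
    _ = 𝟙 _ ⊗≫ Y ◁ η_ V Y ⊗≫
        Y ◁ V ◁ Y ◁ η_ V Y ⊗≫
        Y ◁ V ◁ Y ◁ g ▷ Y ⊗≫
        Y ◁ (f ▷ ((Y ⊗ V) ⊗ E ⊗ Y) ≫ (V ⊗ C) ◁ (ε_ V Y ▷ (E ⊗ Y))) ⊗≫
        ε_ V Y ▷ (C ⊗ E ⊗ Y) ⊗≫ 𝟙 _ := by
      rw [← whisker_exchange]; monoidal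
    _ = 𝟙 _ ⊗≫ Y ◁ (η_ V Y ▷ (𝟙_ D) ≫
          (V ⊗ Y) ◁ η_ V Y) ⊗≫
        Y ◁ V ◁ Y ◁ g ▷ Y ⊗≫
        Y ◁ V ◁ (ε_ V Y ▷ (E ⊗ Y)) ⊗≫ Y ◁ f ▷ (E ⊗ Y) ⊗≫
        ε_ V Y ▷ (C ⊗ E ⊗ Y) ⊗≫ 𝟙 _ := by
      rw [← whisker_exchange]; monoidal
    _ = 𝟙 _ ⊗≫ Y ◁ η_ V Y ⊗≫
        Y ◁ (η_ V Y ▷ (V ⊗ Y) ≫ (V ⊗ Y) ◁ g ▷ Y) ⊗≫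
        Y ◁ V ◁ (ε_ V Y ▷ (E ⊗ Y)) ⊗≫ Y ◁ f ▷ (E ⊗ Y) ⊗≫
        ε_ V Y ▷ (C ⊗ E ⊗ Y) ⊗≫ 𝟙 _ := by
      rw [← whisker_exchange]; monoidal
    _ = 𝟙 _ ⊗≫ Y ◁ η_ V Y ⊗≫ Y ◁ g ▷ Y ⊗≫
        Y ◁ (η_ V Y ▷ V ⊗≫ V ◁ ε_ V Y) ▷ (E ⊗ Y) ⊗≫
        Y ◁ f ▷ (E ⊗ Y) ⊗≫
        ε_ V Y ▷ (C ⊗ E ⊗ Y) ⊗≫ 𝟙 _ := by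
      rw [← whisker_exchange]; monoidal
    _ = _ := by rw [ExactPairing.evaluation_coevaluation'']; monoidal

open Functor in
/-- A monoidal functor preserves right duals. -/
abbrev mapExactPairing {𝒞 : Type u₁} [Category.{v₁} 𝒞] [MonoidalCategory 𝒞] (F : 𝒞 ⥤ D)
    [F.Monoidal] (X Y : 𝒞) [ExactPairing X Y] : ExactPairing (F.obj X) (F.obj Y) where
  coevaluation' := LaxMonoidal.ε F ≫ F.map (ExactPairing.coevaluation X Y) ≫ OplaxMonoidal.δ F X Y
  evaluation' := LaxMonoidal.μ F Y X ≫ F.map (ExactPairing.evaluation X Y) ≫ OplaxMonoidal.η F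
  coevaluation_evaluation' := by
    have h : F.map (Y ◁ ExactPairing.coevaluation X Y ≫ (α_ Y X Y).inv ≫
        ExactPairing.evaluation X Y ▷ Y) = F.map ((ρ_ Y).hom ≫ (λ_ Y).inv) :=
      congrArg F.map (ExactPairing.coevaluation_evaluation X Y)
    calc
      _ = (F.obj Y ◁ LaxMonoidal.ε F ≫ LaxMonoidal.μ F Y (𝟙_ 𝒞)) ≫
          F.map (Y ◁ ExactPairing.coevaluation X Y ≫ (α_ Y X Y).inv ≫
            ExactPairing.evaluation X Y ▷ Y) ≫
          OplaxMonoidal.δ F (𝟙_ 𝒞) Y ≫ OplaxMonoidal.η F ▷ F.obj Y := by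
        simp only [Functor.map_comp, Functor.Monoidal.map_whiskerLeft,
          Functor.Monoidal.map_whiskerRight, Functor.Monoidal.map_associator_inv,
          Category.assoc, MonoidalCategory.whiskerLeft_comp, comp_whiskerRight,
          Functor.Monoidal.μ_δ_assoc]
      _ = _ := by rw [h]; simp
  evaluation_coevaluation' := by
    have h : F.map (ExactPairing.coevaluation X Y ▷ X ≫ (α_ X Y X).hom ≫
        X ◁ ExactPairing.evaluation X Y) = F.map ((λ_ X).hom ≫ (ρ_ X).inv) :=
      congrArg F.map (ExactPairing.evaluation_coevaluation X Y)
    calc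
      _ = (LaxMonoidal.ε F ▷ F.obj X ≫ LaxMonoidal.μ F (𝟙_ 𝒞) X) ≫
          F.map (ExactPairing.coevaluation X Y ▷ X ≫ (α_ X Y X).hom ≫
            X ◁ ExactPairing.evaluation X Y) ≫
          OplaxMonoidal.δ F X (𝟙_ 𝒞) ≫ F.obj X ◁ OplaxMonoidal.η F := by
        simp only [Functor.map_comp, Functor.Monoidal.map_whiskerLeft,
          Functor.Monoidal.map_whiskerRight, Functor.Monoidal.map_associator,
          Category.assoc, MonoidalCategory.whiskerLeft_comp, comp_whiskerRight,
          Functor.Monoidal.μ_δ_assoc]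
      _ = _ := by rw [h]; simp

end Duals

/-! ## Comodules and bicomodules -/

section Comodules

open scoped ComonObj

variable {D : Type u₂} [Category.{v₂} D] [MonoidalCategory D]

/-- Right comodules over a coalgebra object `C`. -/
structure RightComod (C : D) [ComonObj C] where
  X : D
  coact : X ⟶ X ⊗ C
  coassoc : coact ≫ coact ▷ C ≫ (α_ X C C).hom = coact ≫ X ◁ Δ
  counit : coact ≫ X ◁ ε = (ρ_ X).inv

/-- Left comodules over a coalgebra object `C`. -/
structure LeftComod (C : D) [ComonObj C] where
  X : D
  coact : X ⟶ C ⊗ X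
  coassoc : coact ≫ C ◁ coact = coact ≫ Δ ▷ X ≫ (α_ C C X).hom
  counit : coact ≫ ε ▷ X = (λ_ X).inv

/-- Bicomodules over a coalgebra object `C`. -/
structure Bicomod (C : D) [ComonObj C] where
  X : D
  coactL : X ⟶ C ⊗ X
  coactR : X ⟶ X ⊗ C
  coassocL : coactL ≫ C ◁ coactL = coactL ≫ Δ ▷ X ≫ (α_ C C X).hom
  counitL : coactL ≫ ε ▷ X = (λ_ X).inv
  coassocR : coactR ≫ coactR ▷ C ≫ (α_ X C C).hom = coactR ≫ X ◁ Δ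
  counitR : coactR ≫ X ◁ ε = (ρ_ X).inv
  comm : coactL ≫ C ◁ coactR = coactR ≫ coactL ▷ C ≫ (α_ C X C).hom

variable {C : D} [ComonObj C]

namespace RightComod

/-- Morphisms of right comodules. -/
@[ext]
structure Hom (V W : RightComod C) where
  hom : V.X ⟶ W.X
  comm : V.coact ≫ hom ▷ C = hom ≫ W.coact

instance : Category (RightComod C) where
  Hom V W := Hom V W
  id V := { hom := 𝟙 V.X, comm := by simp }
  comp f g :=
    { hom := f.hom ≫ g.hom
      comm := by rw [comp_whiskerRight, reassoc_of% f.comm, g.comm, Category.assoc] }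

@[ext]
theorem hom_ext {V W : RightComod C} {f g : V ⟶ W} (h : f.hom = g.hom) : f = g :=
  Hom.ext h

@[simp]
theorem id_hom (V : RightComod C) : (𝟙 V : V ⟶ V).hom = 𝟙 V.X := rfl

@[simp]
theorem comp_hom {U V W : RightComod C} (f : U ⟶ V) (g : V ⟶ W) :
    (f ≫ g).hom = f.hom ≫ g.hom := rfl

instance [Preadditive D] [MonoidalPreadditive D] : HasZeroMorphisms (RightComod C) where
  zero V W := ⟨{ hom := 0, comm := by simp }⟩
  comp_zero f W := hom_ext comp_zero
  zero_comp U {V W} f := hom_ext zero_comp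

variable (C) in
/-- `C` as a right comodule over itself. -/
def regular : RightComod C where
  X := C
  coact := Δ
  coassoc := (ComonObj.comul_assoc C).symm
  counit := ComonObj.comul_counit C

/-- The right comodule `S ⊗ V`, for an object `S` and a right comodule `V`. -/
def tensor (S : D) (V : RightComod C) : RightComod C where
  X := S ⊗ V.X
  coact := S ◁ V.coact ≫ (α_ S V.X C).inv
  coassoc := by
    have h := congrArg (fun f => S ◁ f ≫ (α_ S V.X (C ⊗ C)).inv) V.coassoc
    simp only [MonoidalCategory.whiskerLeft_comp, Category.assoc] at h
    calc
      _ = S ◁ V.coact ≫ S ◁ V.coact ▷ C ≫ S ◁ (α_ V.X C C).hom ≫ (α_ S V.X (C ⊗ C)).inv := by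
        monoidal
      _ = _ := by rw [h]; monoidal
  counit := by
    have h := congrArg (fun f => S ◁ f ≫ (α_ S V.X (𝟙_ D)).inv) V.counit
    simp only [MonoidalCategory.whiskerLeft_comp, Category.assoc] at h
    calc
      _ = S ◁ V.coact ≫ S ◁ V.X ◁ ε ≫ (α_ S V.X (𝟙_ D)).inv := by monoidal
      _ = _ := by rw [h]; monoidal

/-- `j : V ⟶ I` is an injective envelope: `I` is injective and `j` is a monomorphism which induces
an isomorphism of socles. The socle being the sum of the simple subcomodules, the last condition
says that every simple subcomodule of `I` is contained in the image of `j`. -/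
structure IsInjectiveEnvelope [Preadditive D] [MonoidalPreadditive D] {V I : RightComod C}
    (j : V ⟶ I) : Prop where
  injective : Injective I
  mono : Mono j
  socle (S : RightComod C) (s : S ⟶ I) : Simple S → Mono s → ∃ t : S ⟶ V, t ≫ j = s

end RightComod

namespace Bicomod

/-- Morphisms of bicomodules. -/
@[ext]
structure Hom (V W : Bicomod C) where
  hom : V.X ⟶ W.X
  commL : V.coactL ≫ C ◁ hom = hom ≫ W.coactL
  commR : V.coactR ≫ hom ▷ C = hom ≫ W.coactR

instance : Category (Bicomod C) where
  Hom V W := Hom V W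
  id V := { hom := 𝟙 V.X, commL := by simp, commR := by simp }
  comp f g :=
    { hom := f.hom ≫ g.hom
      commL := by
        rw [MonoidalCategory.whiskerLeft_comp, reassoc_of% f.commL, g.commL, Category.assoc]
      commR := by rw [comp_whiskerRight, reassoc_of% f.commR, g.commR, Category.assoc] }

@[ext]
theorem hom_ext {V W : Bicomod C} {f g : V ⟶ W} (h : f.hom = g.hom) : f = g :=
  Hom.ext h

@[simp]
theorem id_hom (V : Bicomod C) : (𝟙 V : V ⟶ V).hom = 𝟙 V.X := rfl

@[simp]
theorem comp_hom {U V W : Bicomod C} (f : U ⟶ V) (g : V ⟶ W) :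
    (f ≫ g).hom = f.hom ≫ g.hom := rfl

instance [Preadditive D] [MonoidalPreadditive D] : HasZeroMorphisms (Bicomod C) where
  zero V W := ⟨{ hom := 0, commL := by simp, commR := by simp }⟩
  comp_zero f W := hom_ext comp_zero
  zero_comp U {V W} f := hom_ext zero_comp

end Bicomod

/-- The bicomodule `W ⊠ V`: the object `W ⊗ V`, with left coaction from the left comodule `W` and
right coaction from the right comodule `V`. -/
def boxTensor (W : LeftComod C) (V : RightComod C) : Bicomod C where
  X := W.X ⊗ V.X
  coactL := W.coact ▷ V.X ≫ (α_ C W.X V.X).hom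
  coactR := W.X ◁ V.coact ≫ (α_ W.X V.X C).inv
  coassocL := by
    have h := congrArg (fun f => f ▷ V.X ≫ (α_ C (C ⊗ W.X) V.X).hom) W.coassoc
    simp only [comp_whiskerRight, Category.assoc] at h
    calc
      _ = (W.coact ▷ V.X ≫ (C ◁ W.coact) ▷ V.X ≫ (α_ C (C ⊗ W.X) V.X).hom) ≫
          C ◁ (α_ C W.X V.X).hom := by monoidal
      _ = _ := by rw [h]; monoidal
  counitL := by
    have h := congrArg (fun f => f ▷ V.X ≫ (α_ (𝟙_ D) W.X V.X).hom) W.counit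
    simp only [comp_whiskerRight, Category.assoc] at h
    calc
      _ = W.coact ▷ V.X ≫ ε ▷ W.X ▷ V.X ≫ (α_ (𝟙_ D) W.X V.X).hom := by monoidal
      _ = _ := by rw [h]; monoidal
  coassocR := (RightComod.tensor W.X V).coassoc
  counitR := (RightComod.tensor W.X V).counit
  comm := by
    calc
      _ = (W.coact ▷ V.X ≫ (C ⊗ W.X) ◁ V.coact) ≫ (α_ C W.X (V.X ⊗ C)).hom ≫
          C ◁ (α_ W.X V.X C).inv := by monoidal
      _ = _ := by rw [← whisker_exchange]; monoidal

/-- If `Y` is a right dual of the underlying object of the right comodule `V`, then `Y` is a left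
comodule. -/
def RightComod.dualOn (V : RightComod C) (Y : D) [ExactPairing V.X Y] : LeftComod C where
  X := Y
  coact := dualMate Y V.coact
  coassoc := by
    rw [dualMate_comp, V.coassoc, dualMate_naturality, Category.assoc]
  counit := by
    rw [← dualMate_naturality, V.counit, dualMate_rightUnitor_inv]

/-- Right `C`-comodules whose underlying object lies in `𝒞`. -/
structure FinComod {𝒞 : Type u₁} [Category.{v₁} 𝒞] (ι : 𝒞 ⥤ D) (C : D) [ComonObj C] where
  X : 𝒞
  coact : ι.obj X ⟶ ι.obj X ⊗ C
  coassoc : coact ≫ coact ▷ C ≫ (α_ (ι.obj X) C C).hom = coact ≫ ι.obj X ◁ Δ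
  counit : coact ≫ ι.obj X ◁ ε = (ρ_ (ι.obj X)).inv

namespace FinComod

variable {𝒞 : Type u₁} [Category.{v₁} 𝒞] {ι : 𝒞 ⥤ D}

/-- The underlying right comodule. -/
def toRightComod (V : FinComod ι C) : RightComod C where
  X := ι.obj V.X
  coact := V.coact
  coassoc := V.coassoc
  counit := V.counit

/-- The left comodule `V^*`, on the right dual of `V` in `𝒞`. -/
def dual [MonoidalCategory 𝒞] [RightRigidCategory 𝒞] [ι.Monoidal] (V : FinComod ι C) :
    LeftComod C :=
  letI : ExactPairing V.toRightComod.X (ι.obj (V.X)ᘁ) := mapExactPairing ι V.X (V.X)ᘁ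
  V.toRightComod.dualOn (ι.obj (V.X)ᘁ)

end FinComod

/-! ## The assumptions on the coalgebra -/

variable [Preadditive D] [MonoidalPreadditive D]

/-- Condition (C1): if `L` is a simple right comodule, `S` is a simple object of `𝒞` and
`L ≅ S ⊗ L`, then `S ≅ 𝟙`. -/
def ConditionC1 {𝒞 : Type u₁} [Category.{v₁} 𝒞] [MonoidalCategory 𝒞] [HasZeroMorphisms 𝒞]
    (ι : 𝒞 ⥤ D) (C : D) [ComonObj C] : Prop :=
  ∀ (L : FinComod ι C) (S : 𝒞), Simple L.toRightComod → Simple S →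
    Nonempty (L.toRightComod ≅ L.toRightComod.tensor (ι.obj S)) → Nonempty (S ≅ 𝟙_ 𝒞)

/-- Condition (C2): the bicomodules `L^* ⊠ L'`, for simple right comodules `L` and `L'`, are simple,
and every simple bicomodule is isomorphic to one of them. -/
structure ConditionC2 {𝒞 : Type u₁} [Category.{v₁} 𝒞] [MonoidalCategory 𝒞]
    [RightRigidCategory 𝒞] (ι : 𝒞 ⥤ D) [ι.Monoidal] (C : D) [ComonObj C] : Prop where
  simple (L L' : FinComod ι C) : Simple L.toRightComod → Simple L'.toRightComod →
    Simple (boxTensor L.dual L'.toRightComod)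
  exists_iso (B : Bicomod C) : Simple B → ∃ L L' : FinComod ι C,
    Simple L.toRightComod ∧ Simple L'.toRightComod ∧
      Nonempty (B ≅ boxTensor L.dual L'.toRightComod)

/-- The family `L` is a system of representatives of the simple right comodules modulo
`L ∼ S ⊗ L`, with `S` a simple object of `𝒞`. -/
structure IsOrbitRepresentatives {𝒞 : Type u₁} [Category.{v₁} 𝒞] [HasZeroMorphisms 𝒞]
    {ι : 𝒞 ⥤ D} {A : Type*} (L : A → FinComod ι C) : Prop where
  simple (a : A) : Simple (L a).toRightComod
  unique (a b : A) (S : 𝒞) : Simple S →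
    Nonempty ((L a).toRightComod ≅ (L b).toRightComod.tensor (ι.obj S)) → a = b
  exists_iso (M : FinComod ι C) : Simple M.toRightComod → ∃ (a : A) (S : 𝒞), Simple S ∧
    Nonempty (M.toRightComod ≅ (L a).toRightComod.tensor (ι.obj S))

end Comodules

/-! As a right comodule, `C` is cofree on the unit: comodule morphisms `V ⟶ C` correspond to
morphisms `V.X ⟶ 𝟙_ D` (`toRegular`, `eq_toRegular`). Evaluation on `L^* ⊗ L` thus yields the matrix
coefficients `L^* ⊗ L ⟶ C`, through which every `T ⊗ L ⟶ C` factors. This is a nonzero morphism of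
bicomodules with simple source by (C2), hence a monomorphism (`mono_coeff_hom`). Objects of `𝒞` are
injective in `D`, so evaluation extends to `L^* ⊗ I(L)`, and cofreeness gives `ψ : L^* ⊗ I(L) ⟶ C`.
The `ψ a` turn out to be the coprojections of a coproduct.

Injectivity is tested on socles (`mono_directSumDesc`). Simple objects of `𝒞` are invertible and act
on comodules by self-equivalences, so simple subcomodules of `L^* ⊗ I(L)` lie in `L^* ⊗ L` and have
the form `T ⊗ L`. Distinct representatives share none of these, and on a single `L^* ⊗ L` the map is
mono.

Surjectivity is a dévissage (`FinComod.mem_factorSubgroup`). Comodules are locally finite, so take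
`f : N ⟶ C` with `N` finite. On a simple `S` in `N` it factors through some `L^* ⊗ L`; as `L^* ⊗
I(L)` is injective, the factorization extends to `N`. Subtracting it from `f` leaves a morphism that
kills `S`, hence factors through a smaller comodule.

Both halves concern `Hom(ι T, -)` for `T` in `𝒞`. Morphisms of `D` are natural families of maps
between these functors (`exists_hom`, `hom_ext`), so bijectivity of `⨁ Hom(ι T, L^* ⊗ I(L)) ⟶ Hom(ι
T, C)` suffices. Kernels and images are needed only for morphisms out of objects of `𝒞`, where they
split. -/

/-! ### Ind-objects through their Hom functors on `𝒞` -/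

namespace IsTensorCocompletion

variable {𝒞 : Type u₁} [Category.{v₁} 𝒞] [MonoidalCategory 𝒞]
  {D : Type u₂} [Category.{v₂} D] [MonoidalCategory D] {ι : 𝒞 ⥤ D} [ι.Monoidal]

theorem full (hι : IsTensorCocompletion ι) : ι.Full := by
  obtain ⟨e, ⟨θ⟩⟩ := hι.equivalence_ind
  have : (ι ⋙ e.functor).Full := Functor.Full.of_iso θ.symm
  exact Functor.Full.of_comp_faithful ι e.functor

theorem faithful (hι : IsTensorCocompletion ι) : ι.Faithful := by
  obtain ⟨e, ⟨θ⟩⟩ := hι.equivalence_ind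
  exact Functor.Faithful.of_comp_iso θ

/-- Every object of the cocompletion is a filtered colimit of objects of `𝒞`. -/
theorem exists_presentation (hι : IsTensorCocompletion ι) (X : D) :
    ∃ (J : Type v₁) (_ : SmallCategory J) (_ : IsFiltered J) (F : J ⥤ 𝒞)
      (s : F ⋙ ι ⟶ (Functor.const J).obj X), Nonempty (IsColimit (Cocone.mk X s)) := by
  obtain ⟨e, ⟨θ⟩⟩ := hι.equivalence_ind
  let P := (e.functor.obj X).presentation
  refine ⟨P.I, inferInstance, inferInstance, P.F, ?_⟩
  let c : Cocone (P.F ⋙ ι ⋙ e.functor) :=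
    (Cocone.precompose (Functor.isoWhiskerLeft P.F θ).hom).obj
      ((colimit.cocone (P.F ⋙ Ind.yoneda)).extend (e.functor.obj X).colimitPresentationCompYoneda.hom)
  have hc : IsColimit c :=
    (IsColimit.precomposeHomEquiv (Functor.isoWhiskerLeft P.F θ) _).symm
      (IsColimit.extendIso _ (colimit.isColimit _))
  let s : P.F ⋙ ι ⟶ (Functor.const P.I).obj X :=
    { app := fun i => e.functor.preimage (c.ι.app i)
      naturality := fun i i' f => e.functor.map_injective (by simpa using! c.ι.naturality f) }
  refine ⟨s, ⟨isColimitOfReflects e.functor (IsColimit.ofIsoColimit hc (Cocone.ext (Iso.refl _) ?_))⟩⟩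
  intro i
  simp [s, c]

/-- Objects of `𝒞` are compact in the cocompletion. -/
theorem exists_factor_colimit (hι : IsTensorCocompletion ι) {J : Type v₁} [SmallCategory J]
    [IsFiltered J] {G : J ⥤ D} {c : Cocone G} (hc : IsColimit c) {T : 𝒞} (x : ι.obj T ⟶ c.pt) :
    ∃ (i : J) (y : ι.obj T ⟶ G.obj i), y ≫ c.ι.app i = x := by
  obtain ⟨e, ⟨θ⟩⟩ := hι.equivalence_ind
  -- In presheaves on `𝒞`, filtered colimits of ind-objects are pointwise, and by Yoneda the value
  -- at `T` is `Hom(ι T, -)`.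
  let Ψ : D ⥤ 𝒞ᵒᵖ ⥤ Type v₁ := e.functor ⋙ Ind.inclusion 𝒞
  let θ' : ι ⋙ Ψ ≅ yoneda := Functor.isoWhiskerRight θ (Ind.inclusion 𝒞) ≪≫ Ind.yonedaCompInclusion
  have : PreservesColimitsOfShape J (Ind.inclusion 𝒞) := inferInstance
  let b (X : D) : (ι.obj T ⟶ X) ≃ (Ψ.obj X).obj (Opposite.op T) :=
    (Functor.FullyFaithful.ofFullyFaithful Ψ).homEquiv.trans
      (((θ'.app T).homFromEquiv).trans yonedaEquiv)
  have hb {X Y : D} (f : X ⟶ Y) (y : ι.obj T ⟶ X) :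
      b Y (y ≫ f) = (Ψ.map f).app (Opposite.op T) (b X y) := by
    simp [b, Functor.FullyFaithful.homEquiv, yonedaEquiv_comp, ← Category.assoc]
  have hc' := isColimitOfPreserves (Ψ ⋙ (evaluation _ _).obj (Opposite.op T)) hc
  obtain ⟨i, y, hy⟩ := Types.jointly_surjective _ hc' (b _ x)
  refine ⟨i, (b _).symm y, (b _).injective ?_⟩
  rw [hb, Equiv.apply_symm_apply]
  exact hy

/-- Tensoring preserves the filtered colimit presenting `X`, and `ι.obj T` is compact. -/
theorem exists_factor_tensor (hι : IsTensorCocompletion ι) (V X : D) {T : 𝒞}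
    (x : ι.obj T ⟶ V ⊗ X) :
    ∃ (F : 𝒞) (m : ι.obj F ⟶ X) (y : ι.obj T ⟶ V ⊗ ι.obj F), y ≫ V ◁ m = x := by
  obtain ⟨J, _, _, F, s, ⟨hs⟩⟩ := hι.exists_presentation X
  have := hι.cocontinuous_tensorLeft V
  obtain ⟨i, y, hy⟩ := hι.exists_factor_colimit (isColimitOfPreserves (tensorLeft V) hs) x
  exact ⟨F.obj i, s.app i, y, hy⟩

theorem hom_ext (hι : IsTensorCocompletion ι) {X Z : D} {f g : X ⟶ Z}
    (h : ∀ (T : 𝒞) (x : ι.obj T ⟶ X), x ≫ f = x ≫ g) : f = g := by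
  obtain ⟨J, _, _, F, s, ⟨hs⟩⟩ := hι.exists_presentation X
  exact hs.hom_ext fun i => h _ _

/-- A natural family of maps between restricted representable presheaves comes from a morphism. -/
theorem exists_hom (hι : IsTensorCocompletion ι) {X Z : D}
    (h : ∀ T : 𝒞, (ι.obj T ⟶ X) → (ι.obj T ⟶ Z))
    (nat : ∀ (T T' : 𝒞) (u : T' ⟶ T) (x : ι.obj T ⟶ X), h T' (ι.map u ≫ x) = ι.map u ≫ h T x) :
    ∃ f : X ⟶ Z, ∀ (T : 𝒞) (x : ι.obj T ⟶ X), x ≫ f = h T x := by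
  obtain ⟨J, _, _, F, s, ⟨hs⟩⟩ := hι.exists_presentation X
  have := hι.full
  -- Applying `h` to the legs of the presentation gives a cocone; compactness reduces the formula
  -- for arbitrary `x` to these legs.
  let c : Cocone (F ⋙ ι) := Cocone.mk Z
    { app := fun i => h _ (s.app i)
      naturality := fun i i' f => by
        have := s.naturality f
        dsimp at this ⊢
        rw [Category.comp_id] at this ⊢
        rw [← nat, this] }
  refine ⟨hs.desc c, fun T x => ?_⟩
  obtain ⟨i, y, rfl⟩ := hι.exists_factor_colimit hs x
  obtain ⟨y, rfl⟩ := ι.map_surjective y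
  have h1 := hs.fac c i
  dsimp at h1 ⊢
  rw [Category.assoc, h1, nat]

end IsTensorCocompletion

/-! ### Semisimplicity: splittings, images and injectivity -/

section Semisimple

variable {k : Type*} [Field k] {𝒞 : Type u₁} [Category.{v₁} 𝒞] [Abelian 𝒞] [Linear k 𝒞]
  [MonoidalCategory 𝒞] [MonoidalPreadditive 𝒞] [MonoidalLinear k 𝒞] [RigidCategory 𝒞]

namespace IsSemisimplePointedTensorCategory

theorem exists_decomposition (h𝒞 : IsSemisimplePointedTensorCategory k 𝒞) (X : 𝒞) :
    ∃ (n : ℕ) (S : Fin n → 𝒞) (p : ∀ i, X ⟶ S i) (q : ∀ i, S i ⟶ X),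
      (∀ i, Simple (S i)) ∧ ∑ i, p i ≫ q i = 𝟙 X := by
  obtain ⟨n, S, hS, ⟨e⟩⟩ := h𝒞.semisimple X
  have := Abelian.hasFiniteBiproducts (C := 𝒞)
  let e' : X ≅ ⨁ S := e ≪≫ (biproduct.isoCoproduct S).symm
  refine ⟨n, S, fun i => e'.hom ≫ biproduct.π S i, fun i => biproduct.ι S i ≫ e'.inv, hS, ?_⟩
  have : ∑ i, e'.hom ≫ (biproduct.π S i ≫ biproduct.ι S i) ≫ e'.inv = 𝟙 X := by
    rw [← Preadditive.comp_sum, ← Preadditive.sum_comp, biproduct.total]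
    simp
  simpa using this

/-- Tensoring with an inverse of `S` turns an endomorphism of `S` into one of the unit, a scalar,
and tensoring back recovers it. No algebraic closedness of `k` is involved. -/
theorem exists_smul_id (h𝒞 : IsSemisimplePointedTensorCategory k 𝒞) {S : 𝒞} (hS : Simple S)
    (f : S ⟶ S) : ∃ c : k, f = c • 𝟙 S := by
  obtain ⟨T, ⟨e⟩, ⟨e'⟩⟩ := h𝒞.invertible S hS
  obtain ⟨c, hc⟩ := h𝒞.end_unit.2 (e.inv ≫ f ▷ T ≫ e.hom)
  refine ⟨c, ?_⟩
  have h1 : f ▷ T = (c • 𝟙 S) ▷ T := by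
    have h : e.hom ≫ (c • 𝟙 (𝟙_ 𝒞)) ≫ e.inv = f ▷ T := by
      simp only at hc
      rw [hc]; simp
    rw [← h]
    simp
  have h2 : f ▷ (T ⊗ S) = (c • 𝟙 S) ▷ (T ⊗ S) := by
    rw [whiskerRight_tensor, h1, ← whiskerRight_tensor]
  have h3 : f ▷ 𝟙_ 𝒞 = (c • 𝟙 S) ▷ 𝟙_ 𝒞 := by
    rw [← cancel_epi (S ◁ e'.hom), whisker_exchange, whisker_exchange, h2]
  rw [← cancel_epi (ρ_ S).hom, ← rightUnitor_naturality, h3, rightUnitor_naturality]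

/-- Nonzero morphisms from a simple object are split monomorphisms. -/
theorem exists_retraction (h𝒞 : IsSemisimplePointedTensorCategory k 𝒞) {S X : 𝒞} (hS : Simple S)
    {f : S ⟶ X} (hf : f ≠ 0) : ∃ r : X ⟶ S, f ≫ r = 𝟙 S := by
  obtain ⟨n, S', p, q, hS', h⟩ := h𝒞.exists_decomposition X
  have : ∃ i, f ≫ p i ≠ 0 := by
    by_contra! H
    apply hf
    rw [← Category.comp_id f, ← h, Preadditive.comp_sum]
    exact Finset.sum_eq_zero fun i _ => by rw [← Category.assoc, H, zero_comp]
  obtain ⟨i, hi⟩ := this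
  have := hS' i
  have := isIso_of_hom_simple hi
  exact ⟨p i ≫ inv (f ≫ p i), by rw [← Category.assoc, IsIso.hom_inv_id]⟩

/-- For a simple object `S`, composition identifies `Hom(X, S)` with the dual of `Hom(S, X)`. -/
theorem existsUnique_hom_to_simple (h𝒞 : IsSemisimplePointedTensorCategory k 𝒞) {S : 𝒞}
    (hS : Simple S) (X : 𝒞) (μ : (S ⟶ X) →ₗ[k] k) :
    ∃! τ : X ⟶ S, ∀ t : S ⟶ X, t ≫ τ = μ t • 𝟙 S := by
  obtain ⟨n, S', p, q, hS', h⟩ := h𝒞.exists_decomposition X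
  refine existsUnique_of_exists_of_unique ?_ ?_
  · have key (i : Fin n) : ∃ τ : S' i ⟶ S, ∀ t : S ⟶ S' i, t ≫ τ = μ (t ≫ q i) • 𝟙 S := by
      have := hS' i
      by_cases H : Nonempty (S' i ≅ S)
      · obtain ⟨a⟩ := H
        refine ⟨μ (a.inv ≫ q i) • a.hom, fun t => ?_⟩
        obtain ⟨c, hc⟩ := h𝒞.exists_smul_id hS (t ≫ a.hom)
        have ht : t = c • a.inv := by
          rw [← cancel_mono a.hom, hc]; simp
        subst ht
        simp [mul_comm, smul_smul]
      · refine ⟨0, fun t => ?_⟩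
        have : t = 0 := by
          by_contra ht
          have := isIso_of_hom_simple ht
          exact H ⟨(asIso t).symm⟩
        simp [this]
    choose τ hτ using key
    refine ⟨∑ i, p i ≫ τ i, fun t => ?_⟩
    rw [Preadditive.comp_sum]
    simp_rw [← Category.assoc, hτ, ← Finset.sum_smul, ← map_sum]
    conv_rhs => rw [← Category.comp_id t, ← h, Preadditive.comp_sum]
    simp
  · intro τ τ' hτ hτ'
    rw [← sub_eq_zero]
    by_contra H
    have : ∃ i, q i ≫ (τ - τ') ≠ 0 := by
      by_contra! H'
      apply H
      rw [← Category.id_comp (τ - τ'), ← h, Preadditive.sum_comp]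
      exact Finset.sum_eq_zero fun i _ => by rw [Category.assoc, H', comp_zero]
    obtain ⟨i, hi⟩ := this
    have := hS' i
    have := isIso_of_hom_simple hi
    have h0 : (inv (q i ≫ (τ - τ')) ≫ q i) ≫ (τ - τ') = 0 := by
      rw [Preadditive.comp_sub, hτ, hτ', sub_self]
    rw [Category.assoc, IsIso.inv_hom_id] at h0
    exact id_nonzero S h0

end IsSemisimplePointedTensorCategory

/-- The dimension of the endomorphism algebra, as a measure of the size of an object. -/
noncomputable def endDim (k : Type*) [Field k] {𝒞 : Type u₁} [Category.{v₁} 𝒞] [Preadditive 𝒞]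
    [Linear k 𝒞] (X : 𝒞) : ℕ := Module.finrank k (X ⟶ X)

namespace IsSemisimplePointedTensorCategory

theorem endDim_le (h𝒞 : IsSemisimplePointedTensorCategory k 𝒞) {P X : 𝒞} {i : P ⟶ X} {r : X ⟶ P}
    (h : i ≫ r = 𝟙 P) : endDim k P ≤ endDim k X := by
  have := h𝒞.finite_hom X X
  refine LinearMap.finrank_le_finrank_of_injective
    (f := (Linear.rightComp k X i).comp (Linear.leftComp k P r)) fun f g hfg => ?_
  have : i ≫ (r ≫ f ≫ i) ≫ r = i ≫ (r ≫ g ≫ i) ≫ r := by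
    simpa using congrArg (fun e => i ≫ e ≫ r) hfg
  simpa [reassoc_of% h, h] using this

/-- The injection `f ↦ r ≫ f ≫ i` of `End P` into `End X` is onto by dimension, so `𝟙 X` factors
through `P`. Hence `endDim` drops strictly on proper retracts and can drive minimality and induction
arguments. -/
theorem eq_id_of_endDim_le (h𝒞 : IsSemisimplePointedTensorCategory k 𝒞) {P X : 𝒞} {i : P ⟶ X}
    {r : X ⟶ P} (h : i ≫ r = 𝟙 P) (hle : endDim k X ≤ endDim k P) : r ≫ i = 𝟙 X := by
  have := h𝒞.finite_hom X X
  have := h𝒞.finite_hom P P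
  let φ := (Linear.rightComp k X i).comp (Linear.leftComp k P r)
  have inj : Function.Injective φ := fun f g hfg => by
    have : i ≫ (r ≫ f ≫ i) ≫ r = i ≫ (r ≫ g ≫ i) ≫ r := by
      simpa [φ] using congrArg (fun e => i ≫ e ≫ r) hfg
    simpa [reassoc_of% h, h] using this
  have surj : Function.Surjective φ :=
    (LinearMap.injective_iff_surjective_of_finrank_eq_finrank
      (le_antisymm (h𝒞.endDim_le h) hle)).1 inj
  obtain ⟨f, hf⟩ := surj (𝟙 X)
  replace hf : r ≫ f ≫ i = 𝟙 X := by simpa [φ] using hf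
  have h2 : r ≫ i = (r ≫ i) ≫ r ≫ f ≫ i := by rw [hf, Category.comp_id]
  rw [h2, Category.assoc, reassoc_of% h, hf]

end IsSemisimplePointedTensorCategory

variable {D : Type u₂} [Category.{v₂} D] [Abelian D] [MonoidalCategory D]
    {ι : 𝒞 ⥤ D} [ι.Monoidal] [ι.Additive]

namespace IsTensorCocompletion

/-- A nonzero morphism remains nonzero on some simple object of `𝒞`. -/
theorem exists_simple_comp_ne_zero (h𝒞 : IsSemisimplePointedTensorCategory k 𝒞)
    (hι : IsTensorCocompletion ι) {X Y : D} {f : X ⟶ Y} (hf : f ≠ 0) :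
    ∃ (S : 𝒞) (x : ι.obj S ⟶ X), Simple S ∧ x ≫ f ≠ 0 := by
  by_contra! H
  refine hf (hι.hom_ext fun T x => ?_)
  obtain ⟨n, S, p, q, hS, h⟩ := h𝒞.exists_decomposition T
  rw [comp_zero, ← Category.id_comp (x ≫ f), ← ι.map_id, ← h, ι.map_sum, Preadditive.sum_comp]
  refine Finset.sum_eq_zero fun i _ => ?_
  have := H (S i) (ι.map (q i) ≫ x) (hS i)
  rw [ι.map_comp, Category.assoc, ← Category.assoc _ x, this, comp_zero]

/-- A morphism from an object of `𝒞` is a split epimorphism in `𝒞` followed by a monomorphism. -/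
theorem exists_image (h𝒞 : IsSemisimplePointedTensorCategory k 𝒞)
    (hι : IsTensorCocompletion ι) {T : 𝒞} {X : D} (x : ι.obj T ⟶ X) :
    ∃ (W : 𝒞) (q : T ⟶ W) (s : W ⟶ T) (w : ι.obj W ⟶ X),
      s ≫ q = 𝟙 W ∧ ι.map q ≫ w = x ∧ Mono w := by
  have := hι.full
  have := hι.faithful
  have hex : ∃ n, ∃ (W : 𝒞) (q : T ⟶ W) (s : W ⟶ T) (w : ι.obj W ⟶ X),
      s ≫ q = 𝟙 W ∧ ι.map q ≫ w = x ∧ endDim k W = n :=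
    ⟨_, T, 𝟙 T, 𝟙 T, x, by simp, by simp, rfl⟩
  classical
  obtain ⟨W, q, s, w, h1, h2, h3⟩ := Nat.find_spec hex
  refine ⟨W, q, s, w, h1, h2, Preadditive.mono_of_kernel_zero ?_⟩
  by_contra H
  obtain ⟨S, y, hS, hy⟩ := hι.exists_simple_comp_ne_zero h𝒞 H
  obtain ⟨a, ha⟩ := ι.map_surjective (y ≫ kernel.ι w)
  have ha0 : a ≠ 0 := fun h => hy (by rw [← ha, h, ι.map_zero])
  have haw : ι.map a ≫ w = 0 := by rw [ha, Category.assoc, kernel.condition, comp_zero]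
  obtain ⟨b, hb⟩ := h𝒞.exists_retraction hS ha0
  -- Split off from `W` the copy of `S` killed by `w`: `x` still factors through the complement
  -- `W'`, against minimality of `endDim k W`.
  obtain ⟨W', i, r, hir, hri⟩ := IsIdempotentComplete.idempotents_split W (𝟙 W - b ≫ a)
    (Idempotents.idem_of_id_sub_idem _ (by rw [Category.assoc, reassoc_of% hb]))
  have hsplit : (i ≫ s) ≫ q ≫ r = 𝟙 W' := by
    rw [Category.assoc, reassoc_of% h1, hir]
  have hfac : ι.map (q ≫ r) ≫ ι.map i ≫ w = x := by
    rw [ι.map_comp, Category.assoc, ← ι.map_comp_assoc r i, hri, ι.map_sub, Preadditive.sub_comp,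
      ι.map_comp b a, Category.assoc, haw]
    simpa using h2
  have hmin := Nat.find_min' hex ⟨W', q ≫ r, i ≫ s, ι.map i ≫ w, hsplit, hfac, rfl⟩
  rw [← h3] at hmin
  have := h𝒞.eq_id_of_endDim_le hir hmin
  rw [hri] at this
  have hba : b ≫ a = 0 := by simpa using this
  apply ha0
  rw [← Category.id_comp a, ← hb, Category.assoc, hba, comp_zero]

variable [Linear k D] [ι.Linear k]

/-- A linear functional on `Hom(ι S, X)` comes from a morphism `X ⟶ ι.obj S`: by
`existsUnique_hom_to_simple` on objects of `𝒞`, then for all `X` by `exists_hom`. Extending `g`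
along `f` becomes extending a functional from the subspace `Hom(ι S, Y)` to `Hom(ι S, X)`. -/
theorem injective_obj_of_simple (h𝒞 : IsSemisimplePointedTensorCategory k 𝒞)
    (hι : IsTensorCocompletion ι) {S : 𝒞} (hS : Simple S) : Injective (ι.obj S) := by
  have := hι.full
  have := hι.faithful
  refine ⟨fun {Y X} g f _ => ?_⟩
  have hμ (t : ι.obj S ⟶ Y) : ∃ c : k, t ≫ g = c • 𝟙 (ι.obj S) := by
    obtain ⟨a, ha⟩ := ι.map_surjective (t ≫ g)
    obtain ⟨c, hc⟩ := h𝒞.exists_smul_id hS a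
    exact ⟨c, by rw [← ha, hc, ι.map_smul, ι.map_id]⟩
  have hid : 𝟙 (ι.obj S) ≠ 0 := fun h => id_nonzero S
    (ι.map_injective (by rw [ι.map_id, h, ι.map_zero]))
  choose μ hμ using hμ
  let μ' : (ι.obj S ⟶ Y) →ₗ[k] k :=
    { toFun := μ
      map_add' := fun a b => smul_left_injective k hid (by
        change μ (a + b) • 𝟙 (ι.obj S) = (μ a + μ b) • 𝟙 (ι.obj S)
        rw [← hμ, add_smul, ← hμ, ← hμ, Preadditive.add_comp])
      map_smul' := fun c a => smul_left_injective k hid (by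
        change μ (c • a) • 𝟙 (ι.obj S) = (c * μ a) • 𝟙 (ι.obj S)
        rw [← hμ, mul_smul, ← hμ, Linear.smul_comp]) }
  obtain ⟨r, hr⟩ := (Linear.rightComp k (ι.obj S) f).exists_leftInverse_of_injective
    (LinearMap.ker_eq_bot.2 fun a b hab => (cancel_mono f).1 (by simpa using hab))
  let lam := μ'.comp r
  have hlam (t : ι.obj S ⟶ Y) : lam (t ≫ f) = μ t := by
    have := LinearMap.congr_fun hr t
    simp only [LinearMap.comp_apply, LinearMap.id_apply, Linear.rightComp_apply] at this
    simp [lam, this, μ']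
  have key (T : 𝒞) (x : ι.obj T ⟶ X) := h𝒞.existsUnique_hom_to_simple hS T
    ((lam.comp (Linear.rightComp k (ι.obj S) x)).comp (ι.mapLinearMap k))
  choose τ hτ hτ' using key
  simp only [LinearMap.comp_apply, Linear.rightComp_apply, Functor.coe_mapLinearMap] at hτ hτ'
  obtain ⟨g', hg'⟩ := hι.exists_hom (X := X) (Z := ι.obj S) (fun T x => ι.map (τ T x)) (by
    intro T T' u x
    rw [← ι.map_comp]
    congr 1
    -- Naturality follows from uniqueness: both sides represent the same functional on `Hom(S, T')`.
    refine (hτ' _ _ _ fun t => ?_).symm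
    rw [← Category.assoc, hτ]
    simp)
  refine ⟨g', hι.hom_ext fun T y => ?_⟩
  obtain ⟨a, ha⟩ := ι.map_surjective (y ≫ g)
  rw [← Category.assoc, hg', ← ha]
  congr 1
  refine (hτ' _ _ _ fun t => ι.map_injective ?_).symm
  rw [ι.map_comp, ha, ← Category.assoc, hμ, ← hlam]
  simp

theorem injective_obj (h𝒞 : IsSemisimplePointedTensorCategory k 𝒞)
    (hι : IsTensorCocompletion ι) (F : 𝒞) : Injective (ι.obj F) := by
  obtain ⟨n, S, p, q, hS, h⟩ := h𝒞.exists_decomposition F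
  refine ⟨fun {Y X} g f _ => ?_⟩
  have (i : Fin n) := hι.injective_obj_of_simple h𝒞 (hS i)
  refine ⟨∑ i, Injective.factorThru (g ≫ ι.map (p i)) f ≫ ι.map (q i), ?_⟩
  rw [Preadditive.comp_sum]
  simp only [Injective.comp_factorThru_assoc, Category.assoc, ← ι.map_comp]
  rw [← Preadditive.comp_sum, ← ι.map_sum, h]
  simp

theorem exists_retraction (h𝒞 : IsSemisimplePointedTensorCategory k 𝒞)
    (hι : IsTensorCocompletion ι) {F : 𝒞} {X : D} (m : ι.obj F ⟶ X) [Mono m] :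
    ∃ r : X ⟶ ι.obj F, m ≫ r = 𝟙 _ := by
  have := hι.injective_obj h𝒞 F
  exact ⟨Injective.factorThru (𝟙 _) m, by simp⟩

end IsTensorCocompletion

end Semisimple

theorem mono_of_retraction {D : Type u₂} [Category.{v₂} D] {W V : D} {i : W ⟶ V}
    {r : V ⟶ W} (hr : i ≫ r = 𝟙 W) : Mono i :=
  (SplitMono.mk r hr).mono

/-! ### Stable retracts as subcomodules -/

section Subcomodules

open scoped ComonObj

variable {D : Type u₂} [Category.{v₂} D] [MonoidalCategory D] {C : D} [ComonObj C]

/-- Split monomorphisms stay split after tensoring, so coactions on a summand can be compared in the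
ambient object without exactness of `- ⊗ C`. -/
theorem whiskerRight_mono_of_retraction {W V : D} {i : W ⟶ V} {r : V ⟶ W} (hr : i ≫ r = 𝟙 W)
    (C : D) : Mono (i ▷ C) :=
  mono_of_retraction (r := r ▷ C) (by rw [← comp_whiskerRight, hr, id_whiskerRight])

theorem whiskerLeft_mono_of_retraction {W V : D} {i : W ⟶ V} {r : V ⟶ W} (hr : i ≫ r = 𝟙 W)
    (C : D) : Mono (C ◁ i) :=
  mono_of_retraction (r := C ◁ r)
    (by rw [← MonoidalCategory.whiskerLeft_comp, hr, MonoidalCategory.whiskerLeft_id])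

/-- A retract of a right comodule which is stable under the coaction. -/
@[simps]
def RightComod.restrict (V : RightComod C) {W : D} (i : W ⟶ V.X) (r : V.X ⟶ W) (hr : i ≫ r = 𝟙 W)
    (c : W ⟶ W ⊗ C) (h : c ≫ i ▷ C = i ≫ V.coact) : RightComod C where
  X := W
  coact := c
  coassoc := by
    have := whiskerRight_mono_of_retraction hr (C ⊗ C)
    rw [← cancel_mono (i ▷ (C ⊗ C))]
    calc
      _ = c ≫ (c ≫ i ▷ C) ▷ C ≫ (α_ V.X C C).hom := by
        simp only [Category.assoc, comp_whiskerRight, associator_naturality_left]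
      _ = (c ≫ i ▷ C) ≫ V.coact ▷ C ≫ (α_ V.X C C).hom := by
        rw [h]; simp only [comp_whiskerRight, Category.assoc, reassoc_of% h]
      _ = (c ≫ i ▷ C) ≫ V.X ◁ Δ := by rw [h, Category.assoc, V.coassoc, Category.assoc]
      _ = _ := by rw [Category.assoc, Category.assoc, whisker_exchange]
  counit := by
    have := whiskerRight_mono_of_retraction hr (𝟙_ D)
    rw [← cancel_mono (i ▷ (𝟙_ D)), Category.assoc, whisker_exchange, reassoc_of% h, V.counit]
    simp

/-- The inclusion of a stable retract. -/
@[simps]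
def RightComod.restrictHom (V : RightComod C) {W : D} (i : W ⟶ V.X) (r : V.X ⟶ W)
    (hr : i ≫ r = 𝟙 W) (c : W ⟶ W ⊗ C) (h : c ≫ i ▷ C = i ≫ V.coact) : V.restrict i r hr c h ⟶ V where
  hom := i
  comm := h

/-- A retract of a bicomodule which is stable under both coactions. -/
@[simps]
def Bicomod.restrict (V : Bicomod C) {W : D} (i : W ⟶ V.X) (r : V.X ⟶ W) (hr : i ≫ r = 𝟙 W)
    (c : W ⟶ W ⊗ C) (h : c ≫ i ▷ C = i ≫ V.coactR)
    (d : W ⟶ C ⊗ W) (h' : d ≫ C ◁ i = i ≫ V.coactL) : Bicomod C where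
  X := W
  coactL := d
  coactR := c
  coassocL := by
    have := whiskerLeft_mono_of_retraction (
      show C ◁ i ≫ C ◁ r = 𝟙 _ by
        rw [← MonoidalCategory.whiskerLeft_comp, hr, MonoidalCategory.whiskerLeft_id]) C
    rw [← cancel_mono (C ◁ C ◁ i)]
    calc
      _ = d ≫ C ◁ (d ≫ C ◁ i) := by
        simp only [Category.assoc, MonoidalCategory.whiskerLeft_comp]
      _ = (d ≫ C ◁ i) ≫ C ◁ V.coactL := by
        rw [h']; simp only [Category.assoc, MonoidalCategory.whiskerLeft_comp, reassoc_of% h']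
      _ = (d ≫ C ◁ i) ≫ Δ ▷ V.X ≫ (α_ C C V.X).hom := by
        rw [h', Category.assoc, V.coassocL, Category.assoc]
      _ = _ := by
        rw [Category.assoc, whisker_exchange_assoc]; simp
  counitL := by
    have := whiskerLeft_mono_of_retraction hr (𝟙_ D)
    rw [← cancel_mono ((𝟙_ D) ◁ i), Category.assoc, ← whisker_exchange, reassoc_of% h', V.counitL]
    simp
  coassocR := (RightComod.restrict ⟨V.X, V.coactR, V.coassocR, V.counitR⟩ i r hr c h).coassoc
  counitR := (RightComod.restrict ⟨V.X, V.coactR, V.coassocR, V.counitR⟩ i r hr c h).counit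
  comm := by
    have h1 : (C ◁ i ▷ C) ≫ (C ◁ r ▷ C) = 𝟙 _ := by
      rw [← MonoidalCategory.whiskerLeft_comp, ← comp_whiskerRight, hr]; simp
    have : Mono (C ◁ i ▷ C) := mono_of_retraction h1
    rw [← cancel_mono (C ◁ i ▷ C)]
    calc
      _ = d ≫ C ◁ (c ≫ i ▷ C) := by
        simp only [Category.assoc, MonoidalCategory.whiskerLeft_comp]
      _ = (d ≫ C ◁ i) ≫ C ◁ V.coactR := by
        rw [h]; simp only [Category.assoc, MonoidalCategory.whiskerLeft_comp]
      _ = (c ≫ i ▷ C) ≫ V.coactL ▷ C ≫ (α_ C V.X C).hom := by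
        rw [h', Category.assoc, V.comm, h, Category.assoc]
      _ = c ≫ (d ≫ C ◁ i) ▷ C ≫ (α_ C V.X C).hom := by
        rw [h']; simp only [Category.assoc, comp_whiskerRight]
      _ = _ := by simp

/-- The inclusion of a stable retract. -/
@[simps]
def Bicomod.restrictHom (V : Bicomod C) {W : D} (i : W ⟶ V.X) (r : V.X ⟶ W) (hr : i ≫ r = 𝟙 W)
    (c : W ⟶ W ⊗ C) (h : c ≫ i ▷ C = i ≫ V.coactR)
    (d : W ⟶ C ⊗ W) (h' : d ≫ C ◁ i = i ≫ V.coactL) : V.restrict i r hr c h d h' ⟶ V where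
  hom := i
  commL := h'
  commR := h

theorem RightComod.mono_of_mono_hom {V W : RightComod C} (f : V ⟶ W) [Mono f.hom] : Mono f :=
  ⟨fun _ _ e => RightComod.hom_ext ((cancel_mono f.hom).1 (congrArg Hom.hom e))⟩

theorem Bicomod.mono_of_mono_hom {V W : Bicomod C} (f : V ⟶ W) [Mono f.hom] : Mono f :=
  ⟨fun _ _ e => Bicomod.hom_ext ((cancel_mono f.hom).1 (congrArg Hom.hom e))⟩

theorem RightComod.isIso_of_isIso_hom {V W : RightComod C} (f : V ⟶ W) [IsIso f.hom] : IsIso f :=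
  ⟨⟨⟨inv f.hom, by rw [IsIso.eq_inv_comp, ← reassoc_of% f.comm, ← comp_whiskerRight,
      IsIso.hom_inv_id, id_whiskerRight, Category.comp_id]⟩,
    RightComod.hom_ext (IsIso.hom_inv_id f.hom), RightComod.hom_ext (IsIso.inv_hom_id f.hom)⟩⟩

/-- A finite retract of a right comodule which is stable under the coaction. -/
@[simps]
def FinComod.restrict {𝒞 : Type u₁} [Category.{v₁} 𝒞] {ι : 𝒞 ⥤ D} (V : RightComod C) {W : 𝒞}
    (i : ι.obj W ⟶ V.X) (r : V.X ⟶ ι.obj W) (hr : i ≫ r = 𝟙 _)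
    (c : ι.obj W ⟶ ι.obj W ⊗ C) (h : c ≫ i ▷ C = i ≫ V.coact) : FinComod ι C where
  X := W
  coact := c
  coassoc := (V.restrict i r hr c h).coassoc
  counit := (V.restrict i r hr c h).counit

end Subcomodules

/-! ### Local finiteness, kernels and simple comodules -/

section FiniteComodules

open scoped ComonObj

variable {k : Type*} [Field k] {𝒞 : Type u₁} [Category.{v₁} 𝒞] [Abelian 𝒞] [Linear k 𝒞]
  [MonoidalCategory 𝒞] [MonoidalPreadditive 𝒞] [MonoidalLinear k 𝒞] [RigidCategory 𝒞]
  {D : Type u₂} [Category.{v₂} D] [Abelian D] [MonoidalCategory D]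
  {ι : 𝒞 ⥤ D} [ι.Monoidal] [ι.Additive]

/-- A morphism from an object of `𝒞` is the projection onto a direct summand followed by a
monomorphism. -/
theorem IsTensorCocompletion.exists_kernel_image (h𝒞 : IsSemisimplePointedTensorCategory k 𝒞)
    (hι : IsTensorCocompletion ι) {T : 𝒞} {X : D} (x : ι.obj T ⟶ X) :
    ∃ (W P : 𝒞) (q : T ⟶ W) (s : W ⟶ T) (i : P ⟶ T) (r : T ⟶ P) (w : ι.obj W ⟶ X),
      s ≫ q = 𝟙 W ∧ i ≫ r = 𝟙 P ∧ q ≫ s + r ≫ i = 𝟙 T ∧ i ≫ q = 0 ∧ ι.map q ≫ w = x ∧ Mono w := by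
  obtain ⟨W, q, s, w, h1, h2, hw⟩ := hι.exists_image h𝒞 x
  obtain ⟨P, i, r, hir, hri⟩ := IsIdempotentComplete.idempotents_split T (𝟙 T - q ≫ s)
    (Idempotents.idem_of_id_sub_idem _ (by rw [Category.assoc, reassoc_of% h1]))
  refine ⟨W, P, q, s, i, r, w, h1, hir, by rw [hri]; abel, ?_, h2, hw⟩
  rw [← Category.id_comp i, ← hir, Category.assoc, Category.assoc, reassoc_of% hri,
    Preadditive.sub_comp, Category.assoc, h1]
  simp

variable [Linear k D] [ι.Linear k] {C : D} [ComonObj C]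

open Functor in
/-- Comodules are locally finite. -/
theorem RightComod.exists_finComod (h𝒞 : IsSemisimplePointedTensorCategory k 𝒞)
    (hι : IsTensorCocompletion ι) (V : RightComod C) {T : 𝒞} (x : ι.obj T ⟶ V.X) :
    ∃ (N : FinComod ι C) (y : ι.obj T ⟶ N.toRightComod.X) (f : N.toRightComod ⟶ V),
      y ≫ f.hom = x ∧ Mono f.hom := by
  -- The coaction on `x` involves only a part of `C` lying in `𝒞`; passing to its image makes that
  -- part a retract `F` of `C`.
  obtain ⟨F₀, m₀, y₀, hy₀⟩ := hι.exists_factor_tensor V.X C (x ≫ V.coact)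
  obtain ⟨F, q₀, -, m, -, hm₀, hm⟩ := hι.exists_image h𝒞 m₀
  obtain ⟨r, hr⟩ := hι.exists_retraction h𝒞 m
  let x' : ι.obj T ⟶ V.X ⊗ ι.obj F := y₀ ≫ V.X ◁ ι.map q₀
  have hx' : x' ≫ V.X ◁ m = x ≫ V.coact := by
    rw [← hy₀, Category.assoc, ← MonoidalCategory.whiskerLeft_comp, hm₀]
  let : ExactPairing (ι.obj (ᘁF)) (ι.obj F) := mapExactPairing ι (ᘁF) F
  let Φ (X Z : D) := tensorRightHomEquiv X (ι.obj (ᘁF)) (ι.obj F) Z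
  -- Moving `F` across by duality gives `T ⊗ ᘁF ⟶ V`, whose image `W` is the span of the
  -- coefficients of the coaction on `x`.
  obtain ⟨W, q, s, i, hsq, hqi, hi⟩ := hι.exists_image h𝒞
    ((Monoidal.μIso ι T (ᘁF)).inv ≫ (Φ _ _).symm x')
  obtain ⟨ρ, hρ⟩ := hι.exists_retraction h𝒞 i
  let u : ι.obj T ⊗ ι.obj (ᘁF) ⟶ ι.obj W := (Monoidal.μIso ι T (ᘁF)).hom ≫ ι.map q
  have hu : u ≫ i = (Φ _ _).symm x' := by
    simp only [u, Category.assoc]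
    rw [hqi, Iso.hom_inv_id_assoc]
  let x'' : ι.obj T ⟶ ι.obj W ⊗ ι.obj F := Φ _ _ u
  have hx'' : x'' ≫ i ▷ ι.obj F = x' := by
    rw [← tensorRightHomEquiv_naturality, hu, Equiv.apply_symm_apply]
  -- Coassociativity: coacting on the coefficients of `x` amounts to applying `Δ` to `F`, so the
  -- result stays in `W ⊗ C ⊗ F`.
  have hco : x' ≫ V.coact ▷ ι.obj F =
      (x'' ≫ ι.obj W ◁ (m ≫ Δ ≫ C ◁ r) ≫ (α_ _ _ _).inv) ≫ i ▷ C ▷ ι.obj F := by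
    calc
      _ = (x' ≫ V.X ◁ m) ≫ V.X ◁ r ≫ V.coact ▷ ι.obj F := by
        generalize x' = z
        rw [Category.assoc, ← MonoidalCategory.whiskerLeft_comp_assoc V.X m r, hr]; simp
      _ = x ≫ (V.coact ≫ V.coact ▷ C ≫ (α_ _ _ _).hom) ≫ (α_ _ _ _).inv ≫ (V.X ⊗ C) ◁ r := by
        rw [hx', whisker_exchange]; simp
      _ = (x' ≫ V.X ◁ m) ≫ V.X ◁ Δ ≫ (α_ _ _ _).inv ≫ (V.X ⊗ C) ◁ r := by
        rw [V.coassoc, hx']; simp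
      _ = x'' ≫ i ▷ ι.obj F ≫ V.X ◁ (m ≫ Δ ≫ C ◁ r) ≫ (α_ _ _ _).inv := by
        rw [← hx'']; simp
      _ = _ := by rw [← whisker_exchange_assoc]; simp
  have hi' : i = ι.map s ≫ (Monoidal.μIso ι T (ᘁF)).inv ≫ (Φ _ _).symm x' := by
    rw [← hqi, ← ι.map_comp_assoc, hsq]; simp
  have hc : ∃ c : ι.obj W ⟶ ι.obj W ⊗ C, c ≫ i ▷ C = i ≫ V.coact := by
    refine ⟨ι.map s ≫ (Monoidal.μIso ι T (ᘁF)).inv ≫ (Φ _ _).symm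
      (x'' ≫ ι.obj W ◁ (m ≫ Δ ≫ C ◁ r) ≫ (α_ _ _ _).inv), ?_⟩
    conv_rhs => rw [hi']
    simp only [Category.assoc]
    congr 2
    apply (Φ _ _).injective
    simp only [Φ]
    rw [tensorRightHomEquiv_naturality, tensorRightHomEquiv_naturality]
    simp only [Equiv.apply_symm_apply]
    rw [hco]
  obtain ⟨c, hc⟩ := hc
  -- The counit recovers `x` from its coefficients, so `x` factors through `W`.
  refine ⟨FinComod.restrict V i ρ hρ c hc, x'' ≫ ι.obj W ◁ (m ≫ ε) ≫ (ρ_ _).hom,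
    V.restrictHom i ρ hρ c hc, ?_, hi⟩
  calc
    _ = (x'' ≫ ι.obj W ◁ (m ≫ ε) ≫ (ρ_ _).hom) ≫ i := rfl
    _ = x'' ≫ (ι.obj W ◁ (m ≫ ε) ≫ i ▷ 𝟙_ D) ≫ (ρ_ _).hom := by
        simp only [Category.assoc, rightUnitor_naturality]
    _ = (x' ≫ V.X ◁ m) ≫ V.X ◁ ε ≫ (ρ_ _).hom := by
      rw [whisker_exchange, ← hx'']; simp
    _ = x := by rw [hx', Category.assoc, reassoc_of% V.counit]; simp

variable [MonoidalPreadditive D]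

namespace FinComod

/-- The image and the kernel of a morphism from a finite comodule. -/
theorem exists_kernel_image (h𝒞 : IsSemisimplePointedTensorCategory k 𝒞)
    (hι : IsTensorCocompletion ι) (N : FinComod ι C) {V : RightComod C} (f : N.toRightComod ⟶ V) :
    ∃ (W P : FinComod ι C) (q : N.toRightComod ⟶ W.toRightComod) (w : W.toRightComod ⟶ V)
      (i : P.toRightComod ⟶ N.toRightComod), q ≫ w = f ∧ Mono w.hom ∧ i ≫ f = 0 ∧ Mono i.hom ∧
      (i.hom = 0 → Mono f.hom) ∧ endDim k W.X ≤ endDim k N.X ∧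
      (endDim k N.X ≤ endDim k W.X → Mono f.hom) := by
  obtain ⟨W, P, q, s, i, r, w, hsq, hir, hqr, hiq, hqw, hw⟩ := hι.exists_kernel_image h𝒞
    (X := V.X) f.hom
  have hsq' : ι.map s ≫ ι.map q = 𝟙 _ := by rw [← ι.map_comp, hsq, ι.map_id]
  have hir' : ι.map i ≫ ι.map r = 𝟙 _ := by rw [← ι.map_comp, hir, ι.map_id]
  have hiq' : ι.map i ≫ ι.map q = 0 := by rw [← ι.map_comp, hiq, ι.map_zero]
  have hqr' : ι.map q ≫ ι.map s + ι.map r ≫ ι.map i = 𝟙 _ := by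
    rw [← ι.map_comp, ← ι.map_comp, ← ι.map_add, hqr, ι.map_id]
  obtain ⟨ρ, hρ⟩ := hι.exists_retraction h𝒞 w
  have := whiskerRight_mono_of_retraction hρ C
  have hfc : N.coact ≫ ι.map q ▷ C ≫ w ▷ C = ι.map q ≫ w ≫ V.coact := by
    rw [← comp_whiskerRight, reassoc_of% hqw, hqw]
    exact f.comm
  have hW : (ι.map s ≫ N.coact ≫ ι.map q ▷ C) ≫ w ▷ C = w ≫ V.coact := by
    simp only [Category.assoc]
    rw [hfc, reassoc_of% hsq']
  have hP : (ι.map i ≫ N.coact ≫ ι.map r ▷ C) ≫ ι.map i ▷ C = ι.map i ≫ N.coact := by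
    have h0 : ι.map i ≫ N.coact ≫ ι.map q ▷ C = 0 := by
      rw [← cancel_mono (w ▷ C), Category.assoc, Category.assoc, hfc, reassoc_of% hiq']
      simp
    have : ι.map i ≫ N.coact ≫ (ι.map q ≫ ι.map s + ι.map r ≫ ι.map i) ▷ C =
        ι.map i ≫ N.coact := by rw [hqr']; simp
    rw [← this, MonoidalPreadditive.add_whiskerRight, Preadditive.comp_add, Preadditive.comp_add,
      comp_whiskerRight, reassoc_of% h0, comp_whiskerRight]
    simp
  refine ⟨restrict V w ρ hρ _ hW, restrict N.toRightComod (ι.map i) (ι.map r) hir' _ hP,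
    { hom := ι.map q, comm := ?_ }, V.restrictHom w ρ hρ _ hW,
    N.toRightComod.restrictHom (ι.map i) (ι.map r) hir' _ hP, RightComod.hom_ext hqw, hw,
    RightComod.hom_ext ?_, mono_of_retraction hir', fun h => ?_, h𝒞.endDim_le hsq, fun h => ?_⟩
  · change N.coact ≫ ι.map q ▷ C = ι.map q ≫ ι.map s ≫ N.coact ≫ ι.map q ▷ C
    rw [← cancel_mono (w ▷ C)]
    simp only [Category.assoc]
    rw [hfc, reassoc_of% hsq']
  · change ι.map i ≫ f.hom = 0
    rw [← hqw, reassoc_of% hiq', zero_comp]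
  · have h : ι.map i = 0 := h
    rw [h, comp_zero, add_zero] at hqr'
    have := mono_of_retraction hqr'
    exact hqw ▸ mono_comp (ι.map q) w
  · have h : ι.map q ≫ ι.map s = 𝟙 _ := by
      rw [← ι.map_comp, h𝒞.eq_id_of_endDim_le hsq h, ι.map_id]
    have := mono_of_retraction h
    exact hqw ▸ mono_comp (ι.map q) w

end FinComod

/-- If `f.hom` had a nonzero kernel in `D`, a nonzero part of it would lie in a finite subcomodule
`N`, and the kernel of `N ⟶ W` is a finite subcomodule killed by `f`. -/
theorem RightComod.mono_hom_of_finComod (h𝒞 : IsSemisimplePointedTensorCategory k 𝒞)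
    (hι : IsTensorCocompletion ι) {V W : RightComod C} (f : V ⟶ W)
    (H : ∀ (P : FinComod ι C) (p : P.toRightComod ⟶ V), Mono p.hom → p ≫ f = 0 → p = 0) :
    Mono f.hom := by
  refine Preadditive.mono_of_kernel_zero ?_
  by_contra H'
  obtain ⟨S, x, -, hx⟩ := hι.exists_simple_comp_ne_zero h𝒞 H'
  obtain ⟨N, y, g, hy, hg⟩ := V.exists_finComod h𝒞 hι (x ≫ kernel.ι f.hom)
  obtain ⟨-, P, -, -, i, -, -, hi, hmi, hi', -, -⟩ := N.exists_kernel_image h𝒞 hι (g ≫ f)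
  have hig : i ≫ g = 0 := H P _ (by rw [comp_hom]; infer_instance) (by rw [Category.assoc, hi])
  have hi0 : i.hom = 0 := (cancel_mono g.hom).1 ((congrArg Hom.hom hig).trans zero_comp.symm)
  have := hi' hi0
  apply hx
  have hy0 : y = 0 := by
    rw [← cancel_mono (g ≫ f).hom, comp_hom]
    rw [reassoc_of% hy, kernel.condition, comp_zero, zero_comp]
  rw [← hy, hy0, zero_comp]

/-- Monomorphisms of comodules are monomorphisms of the underlying objects. -/
theorem RightComod.mono_hom (h𝒞 : IsSemisimplePointedTensorCategory k 𝒞)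
    (hι : IsTensorCocompletion ι) {V W : RightComod C} (f : V ⟶ W) [Mono f] : Mono f.hom :=
  mono_hom_of_finComod h𝒞 hι f fun _ _ _ h => (cancel_mono f).1 (by rw [h, zero_comp])

namespace FinComod

/-- Nonzero finite comodules have simple subcomodules. -/
theorem exists_simple (h𝒞 : IsSemisimplePointedTensorCategory k 𝒞)
    (hι : IsTensorCocompletion ι) (N : FinComod ι C) (hN : 𝟙 N.toRightComod.X ≠ 0) :
    ∃ (S : FinComod ι C) (s : S.toRightComod ⟶ N.toRightComod),
      Simple S.toRightComod ∧ Mono s.hom := by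
  have := hι.full
  have := hι.faithful
  have hex : ∃ n, ∃ (S : FinComod ι C) (s : S.toRightComod ⟶ N.toRightComod),
      𝟙 S.toRightComod.X ≠ 0 ∧ Mono s.hom ∧ endDim k S.X = n :=
    ⟨_, N, 𝟙 _, hN, by dsimp; infer_instance, rfl⟩
  classical
  obtain ⟨S, s, hS, hs, hd⟩ := Nat.find_spec hex
  refine ⟨S, s, ⟨fun {Y} f _ => ⟨?_, fun hf => ?_⟩⟩, hs⟩
  · rintro _ rfl
    have : 𝟙 S.toRightComod = 0 := by rw [← IsIso.inv_hom_id (0 : Y ⟶ S.toRightComod), comp_zero]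
    exact hS (congrArg RightComod.Hom.hom this)
  · have hf' : f.hom ≠ 0 := fun h => hf (RightComod.hom_ext h)
    have := RightComod.mono_hom h𝒞 hι f
    obtain ⟨T, x, -, hx⟩ := hι.exists_simple_comp_ne_zero h𝒞 hf'
    obtain ⟨N', y, g, hy, hg⟩ := Y.exists_finComod h𝒞 hι x
    have hN' : 𝟙 N'.toRightComod.X ≠ 0 := fun h => hx (by
      rw [← hy, ← Category.comp_id y, h, comp_zero, zero_comp, zero_comp])
    have : Mono (g ≫ f).hom := by rw [RightComod.comp_hom]; infer_instance
    -- A nonzero subobject `Y` of `S` contains a nonzero finite `N'`, which is no smaller than `S`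
    -- by minimality, so `N' ⟶ S` is invertible and `f` is a split epimorphism.
    have hmin := Nat.find_min' hex ⟨N', (g ≫ f) ≫ s, hN', by
      rw [RightComod.comp_hom]; infer_instance, rfl⟩
    rw [← hd] at hmin
    have : Mono (X := ι.obj N'.X) (Y := ι.obj S.X) (g ≫ f).hom := this
    obtain ⟨r, hr⟩ := hι.exists_retraction h𝒞 (F := N'.X) (X := ι.obj S.X) (g ≫ f).hom
    obtain ⟨a, ha⟩ := ι.map_surjective (X := N'.X) (Y := S.X) (g ≫ f).hom
    obtain ⟨b, rfl⟩ := ι.map_surjective r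
    have hab : a ≫ b = 𝟙 _ := ι.map_injective (by rw [ι.map_comp, ha, hr, ι.map_id])
    obtain ⟨β, hβ⟩ : ∃ β : S.toRightComod.X ⟶ N'.toRightComod.X, β = ι.map b := ⟨_, rfl⟩
    have hba : (β ≫ g.hom) ≫ f.hom = 𝟙 S.toRightComod.X := by
      have h1 := congrArg ι.map (h𝒞.eq_id_of_endDim_le hab hmin)
      rw [ι.map_comp, ha, ι.map_id] at h1
      rw [Category.assoc, hβ]
      exact h1
    have : IsIso f.hom :=
      ⟨β ≫ g.hom, (cancel_mono f.hom).1 (by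
        rw [Category.assoc, hba, Category.comp_id, Category.id_comp]), hba⟩
    exact RightComod.isIso_of_isIso_hom f

/-- A nonzero finite comodule killed by `f` contains a simple one, so injectivity can be tested on
the socle. -/
theorem _root_.RightComod.mono_hom_of_simple_finComod
    (h𝒞 : IsSemisimplePointedTensorCategory k 𝒞) (hι : IsTensorCocompletion ι)
    {V W : RightComod C} (f : V ⟶ W)
    (H : ∀ (S : FinComod ι C) (s : S.toRightComod ⟶ V), Simple S.toRightComod → s ≫ f = 0 → s = 0) :
    Mono f.hom := by
  refine RightComod.mono_hom_of_finComod h𝒞 hι f fun P p hp hpf => ?_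
  by_cases h : 𝟙 P.toRightComod.X = 0
  · exact RightComod.hom_ext (by rw [← Category.id_comp p.hom, h, zero_comp]; rfl)
  · obtain ⟨S, s, hS, hs⟩ := P.exists_simple h𝒞 hι h
    have hsp := H S (s ≫ p) hS (by rw [Category.assoc, hpf, comp_zero])
    have := RightComod.mono_of_mono_hom p
    have := RightComod.mono_of_mono_hom s
    have hs0 : s = 0 := by rw [← cancel_mono p, hsp, zero_comp]
    have h1 : 𝟙 S.toRightComod = 0 := by rw [← cancel_mono s, hs0, comp_zero, comp_zero]
    exact absurd h1 (id_nonzero _)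

theorem mono_hom_of_simple (h𝒞 : IsSemisimplePointedTensorCategory k 𝒞)
    (hι : IsTensorCocompletion ι) {S : FinComod ι C} (hS : Simple S.toRightComod)
    {V : RightComod C} {f : S.toRightComod ⟶ V} (hf : f ≠ 0) : Mono f.hom := by
  obtain ⟨-, P, -, -, i, -, -, hi, hmi, hi', -, -⟩ := S.exists_kernel_image h𝒞 hι f
  refine hi' ?_
  by_contra h
  have := RightComod.mono_of_mono_hom i
  have : IsIso i := isIso_of_mono_of_nonzero fun h' => h (congrArg RightComod.Hom.hom h')
  exact hf (by rw [← cancel_epi i, hi, comp_zero])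

end FinComod

/-- Nonzero morphisms from a simple bicomodule with underlying object in `𝒞` are monomorphisms of
the underlying objects. -/
theorem Bicomod.mono_hom_of_simple (h𝒞 : IsSemisimplePointedTensorCategory k 𝒞)
    (hι : IsTensorCocompletion ι) {B V : Bicomod C} (hB : Simple B) {X : 𝒞} (e : ι.obj X ≅ B.X)
    {f : B ⟶ V} (hf : f ≠ 0) : Mono f.hom := by
  obtain ⟨W, P, q, s, i, r, w, hsq, hir, hqr, hiq, hqw, hw⟩ := hι.exists_kernel_image h𝒞
    (e.hom ≫ f.hom)
  obtain ⟨Q, hQ⟩ : ∃ Q : B.X ⟶ ι.obj W, Q = e.inv ≫ ι.map q := ⟨_, rfl⟩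
  obtain ⟨S, hS⟩ : ∃ S : ι.obj W ⟶ B.X, S = ι.map s ≫ e.hom := ⟨_, rfl⟩
  obtain ⟨I, hI⟩ : ∃ I : ι.obj P ⟶ B.X, I = ι.map i ≫ e.hom := ⟨_, rfl⟩
  obtain ⟨R, hR'⟩ : ∃ R : B.X ⟶ ι.obj P, R = e.inv ≫ ι.map r := ⟨_, rfl⟩
  have hIR : I ≫ R = 𝟙 _ := by simp [hI, hR', ← ι.map_comp, hir]
  have hIQ : I ≫ Q = 0 := by simp [hI, hQ, ← ι.map_comp, hiq]
  have hQR : Q ≫ S + R ≫ I = 𝟙 _ := by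
    have : e.inv ≫ (ι.map q ≫ ι.map s + ι.map r ≫ ι.map i) ≫ e.hom = 𝟙 _ := by
      rw [← ι.map_comp, ← ι.map_comp, ← ι.map_add, hqr, ι.map_id]; simp
    simpa [hQ, hS, hR', hI] using this
  have hQw : Q ≫ w = f.hom := by simp [hQ, hqw]
  obtain ⟨ρ, hρ⟩ := hι.exists_retraction h𝒞 w
  have := whiskerRight_mono_of_retraction hρ C
  have := whiskerLeft_mono_of_retraction hρ C
  have hR : (I ≫ B.coactR ≫ R ▷ C) ≫ I ▷ C = I ≫ B.coactR := by
    have h0 : I ≫ B.coactR ≫ Q ▷ C = 0 := by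
      rw [← cancel_mono (w ▷ C), Category.assoc, Category.assoc, ← comp_whiskerRight, hQw, f.commR,
        ← hQw, Category.assoc, reassoc_of% hIQ]
      simp
    have : I ≫ B.coactR ≫ (Q ≫ S + R ≫ I) ▷ C = I ≫ B.coactR := by rw [hQR]; simp
    rw [← this, MonoidalPreadditive.add_whiskerRight, Preadditive.comp_add, Preadditive.comp_add,
      comp_whiskerRight, reassoc_of% h0, comp_whiskerRight]
    simp
  have hL : (I ≫ B.coactL ≫ C ◁ R) ≫ C ◁ I = I ≫ B.coactL := by
    have h0 : I ≫ B.coactL ≫ C ◁ Q = 0 := by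
      rw [← cancel_mono (C ◁ w), Category.assoc, Category.assoc,
        ← MonoidalCategory.whiskerLeft_comp, hQw, f.commL,
        ← hQw, Category.assoc, reassoc_of% hIQ]
      simp
    have : I ≫ B.coactL ≫ C ◁ (Q ≫ S + R ≫ I) = I ≫ B.coactL := by rw [hQR]; simp
    rw [← this, MonoidalPreadditive.whiskerLeft_add, Preadditive.comp_add, Preadditive.comp_add,
      MonoidalCategory.whiskerLeft_comp, reassoc_of% h0, MonoidalCategory.whiskerLeft_comp]
    simp
  -- The kernel is stable under both coactions, hence a sub-bicomodule; it is proper since `f ≠ 0`,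
  -- so simplicity makes it zero.
  let j := B.restrictHom I R hIR _ hR _ hL
  have : Mono j.hom := mono_of_retraction hIR
  have := Bicomod.mono_of_mono_hom j
  have hj : ¬ IsIso j := fun _ => hf (by
    rw [← cancel_epi j, comp_zero]
    refine Bicomod.hom_ext ?_
    change I ≫ f.hom = 0
    rw [← hQw, reassoc_of% hIQ, zero_comp])
  have hj0 : j = 0 := by
    by_contra h
    exact hj (isIso_of_mono_of_nonzero h)
  have hI0 : I = 0 := congrArg Bicomod.Hom.hom hj0
  rw [hI0, comp_zero, add_zero] at hQR
  have := mono_of_retraction hQR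
  exact hQw ▸ mono_comp _ _

end FiniteComodules

theorem CategoryTheory.Equivalence.simple_functor_obj {A : Type u₁} [Category.{v₁} A]
    {B : Type u₂} [Category.{v₂} B] [HasZeroMorphisms A] [HasZeroMorphisms B] (e : A ≌ B) {X : A}
    (hX : Simple X) : Simple (e.functor.obj X) where
  mono_isIso_iff_nonzero {Y} f _ := by
    have : Simple ((𝟭 A).obj X) := hX
    have h1 := Simple.mono_isIso_iff_nonzero (e.inverse.map f ≫ (e.unitIso.app X).inv)
    constructor
    · rintro _ rfl
      have := h1.1 inferInstance
      simp at this
    · intro hf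
      have : IsIso (e.inverse.map f ≫ (e.unitIso.app X).inv) := h1.2 fun h => hf (by
        rw [← zero_comp, cancel_mono] at h
        exact e.inverse.map_injective (h.trans (by simp)))
      have : IsIso (e.inverse.map f) := IsIso.of_isIso_comp_right _ (e.unitIso.app X).inv
      exact isIso_of_reflects_iso f e.inverse

/-! ### The action of objects on right comodules -/

namespace RightComod

open scoped ComonObj

variable {D : Type u₂} [Category.{v₂} D] [MonoidalCategory D] {C : D} [ComonObj C]

/-- Isomorphisms of comodules from isomorphisms of the underlying objects. -/
@[simps]
def isoMk {V W : RightComod C} (e : V.X ≅ W.X) (h : V.coact ≫ e.hom ▷ C = e.hom ≫ W.coact) :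
    V ≅ W where
  hom := ⟨e.hom, h⟩
  inv := ⟨e.inv, by rw [Iso.eq_inv_comp, ← reassoc_of% h, ← comp_whiskerRight]; simp⟩
  hom_inv_id := hom_ext e.hom_inv_id
  inv_hom_id := hom_ext e.inv_hom_id

/-- Functoriality of `S ⊗ V` in `S`. -/
@[simps]
def tensorHomLeft {X Y : D} (f : X ⟶ Y) (V : RightComod C) : V.tensor X ⟶ V.tensor Y where
  hom := f ▷ V.X
  comm := by
    have : (X ◁ V.coact ≫ (α_ X V.X C).inv) ≫ f ▷ V.X ▷ C =
        f ▷ V.X ≫ Y ◁ V.coact ≫ (α_ Y V.X C).inv := by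
      rw [← whisker_exchange_assoc]; simp
    exact this

/-- Functoriality of `S ⊗ V` in `V`. -/
@[simps]
def tensorHomRight (X : D) {V W : RightComod C} (f : V ⟶ W) : V.tensor X ⟶ W.tensor X where
  hom := X ◁ f.hom
  comm := by
    have : (X ◁ V.coact ≫ (α_ X V.X C).inv) ≫ (X ◁ f.hom) ▷ C =
        X ◁ f.hom ≫ X ◁ W.coact ≫ (α_ X W.X C).inv := by
      rw [← MonoidalCategory.whiskerLeft_comp_assoc, ← f.comm]; simp
    exact this

/-- Tensoring with an object on the left, as an endofunctor of the category of right comodules. -/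
@[simps]
def tensorFunctor (C : D) [ComonObj C] (X : D) : RightComod C ⥤ RightComod C where
  obj V := V.tensor X
  map f := tensorHomRight X f
  map_id _ := hom_ext (MonoidalCategory.whiskerLeft_id _ _)
  map_comp _ _ := hom_ext (MonoidalCategory.whiskerLeft_comp _ _ _)

/-- Associativity of the action on right comodules. -/
def tensorAssoc (X Y : D) (V : RightComod C) : V.tensor (X ⊗ Y) ≅ (V.tensor Y).tensor X :=
  isoMk (α_ X Y V.X) (by
    change ((X ⊗ Y) ◁ V.coact ≫ _) ≫ _ = _ ≫ X ◁ (Y ◁ V.coact ≫ _) ≫ _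
    monoidal)

/-- Unitality of the action on right comodules. -/
def tensorUnit (V : RightComod C) : V.tensor (𝟙_ D) ≅ V :=
  isoMk (λ_ V.X) (by
    change ((𝟙_ D) ◁ V.coact ≫ _) ≫ _ = _
    monoidal)

/-- The action of isomorphic objects. -/
@[simps]
def tensorIsoLeft {X Y : D} (e : X ≅ Y) (V : RightComod C) : V.tensor X ≅ V.tensor Y where
  hom := tensorHomLeft e.hom V
  inv := tensorHomLeft e.inv V
  hom_inv_id := hom_ext (hom_inv_whiskerRight e V.X)
  inv_hom_id := hom_ext (inv_hom_whiskerRight e V.X)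

/-- An invertible object acts by a self-equivalence. -/
def tensorCancel {X Y : D} (e : X ⊗ Y ≅ 𝟙_ D) :
    tensorFunctor C Y ⋙ tensorFunctor C X ≅ 𝟭 (RightComod C) :=
  NatIso.ofComponents
    (fun V => (tensorAssoc X Y V).symm ≪≫ tensorIsoLeft e V ≪≫ tensorUnit V)
    (fun {V W} f => hom_ext (by
      change X ◁ Y ◁ f.hom ≫ (α_ X Y W.X).inv ≫ e.hom ▷ W.X ≫ (λ_ W.X).hom =
        ((α_ X Y V.X).inv ≫ e.hom ▷ V.X ≫ (λ_ V.X).hom) ≫ f.hom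
      rw [associator_inv_naturality_right_assoc, whisker_exchange_assoc]
      simp))

/-- Transposition along a duality. -/
def transpose (X Y : D) [ExactPairing X Y] {V W : RightComod C} (f : V.tensor Y ⟶ W) :
    V ⟶ W.tensor X :=
  (tensorUnit V).inv ≫ tensorHomLeft (η_ X Y) V ≫ (tensorAssoc X Y V).hom ≫ tensorHomRight X f

/-- Transposition along a duality. -/
def untranspose (X Y : D) [ExactPairing X Y] {V W : RightComod C} (f : V ⟶ W.tensor X) :
    V.tensor Y ⟶ W :=
  tensorHomRight Y f ≫ (tensorAssoc Y X W).inv ≫ tensorHomLeft (ε_ X Y) W ≫ (tensorUnit W).hom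

theorem transpose_untranspose {X Y : D} [ExactPairing X Y] {V W : RightComod C}
    (f : V ⟶ W.tensor X) : transpose X Y (untranspose X Y f) = f :=
  hom_ext ((tensorLeftHomEquiv V.X X Y W.X).apply_symm_apply f.hom)

theorem comp_transpose {X Y : D} [ExactPairing X Y] {U V W : RightComod C} (g : U ⟶ V)
    (f : V.tensor Y ⟶ W) : g ≫ transpose X Y f = transpose X Y (tensorHomRight Y g ≫ f) := by
  have (h : Y ⊗ V.X ⟶ W.X) : g.hom ≫ tensorLeftHomEquiv V.X X Y W.X h =
      tensorLeftHomEquiv U.X X Y W.X (Y ◁ g.hom ≫ h) := by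
    rw [← Equiv.symm_apply_eq, tensorLeftHomEquiv_symm_naturality, Equiv.symm_apply_apply]
  exact hom_ext (this f.hom)

/-- Finite sums of morphisms of comodules. -/
@[simps]
def sumHom [Preadditive D] [MonoidalPreadditive D] {V W : RightComod C} {J : Type*} (s : Finset J)
    (f : J → (V ⟶ W)) : V ⟶ W where
  hom := ∑ i ∈ s, (f i).hom
  comm := by
    rw [sum_whiskerRight, Preadditive.comp_sum, Preadditive.sum_comp]
    exact Finset.sum_congr rfl fun i _ => (f i).comm

theorem comp_sumHom [Preadditive D] [MonoidalPreadditive D] {U V W : RightComod C} {J : Type*}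
    (g : U ⟶ V) (s : Finset J) (f : J → (V ⟶ W)) :
    g ≫ sumHom s f = sumHom s fun i => g ≫ f i :=
  hom_ext (Preadditive.comp_sum _ _ _)

theorem sumHom_comp [Preadditive D] [MonoidalPreadditive D] {U V W : RightComod C} {J : Type*}
    (s : Finset J) (f : J → (U ⟶ V)) (g : V ⟶ W) :
    sumHom s f ≫ g = sumHom s fun i => f i ≫ g :=
  hom_ext (Preadditive.sum_comp _ _ _)

theorem sumHom_eq_zero [Preadditive D] [MonoidalPreadditive D] {V W : RightComod C} {J : Type*}
    {s : Finset J} {f : J → (V ⟶ W)} (h : ∀ i ∈ s, f i = 0) : sumHom s f = 0 :=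
  hom_ext (Finset.sum_eq_zero fun i hi => congrArg Hom.hom (h i hi))

theorem tensorHomRight_comp_tensorHomLeft {X Y : D} (f : X ⟶ Y) {V W : RightComod C} (g : V ⟶ W) :
    tensorHomRight X g ≫ tensorHomLeft f W = tensorHomLeft f V ≫ tensorHomRight Y g :=
  hom_ext (whisker_exchange f g.hom)

theorem sumHom_tensorHomLeft [Preadditive D] [MonoidalPreadditive D] {X : D} {J : Type*}
    [Fintype J] {Y : J → D} {p : ∀ i, X ⟶ Y i} {q : ∀ i, Y i ⟶ X} (h : ∑ i, p i ≫ q i = 𝟙 X)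
    (V : RightComod C) :
    sumHom Finset.univ (fun i => tensorHomLeft (p i) V ≫ tensorHomLeft (q i) V) =
      𝟙 (V.tensor X) := by
  refine hom_ext ?_
  have : ∑ i, (p i ▷ V.X) ≫ (q i ▷ V.X) = 𝟙 (X ⊗ V.X) := by
    simp only [← comp_whiskerRight]
    rw [← sum_whiskerRight, h, id_whiskerRight]
  exact this

end RightComod

/-! ### Invertible twists, injectives and socles -/

section

variable {k : Type*} [Field k] {𝒞 : Type u₁} [Category.{v₁} 𝒞] [Abelian 𝒞] [Linear k 𝒞]
  [MonoidalCategory 𝒞] [MonoidalPreadditive 𝒞] [MonoidalLinear k 𝒞] [RigidCategory 𝒞]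
  {D : Type u₂} [Category.{v₂} D] [MonoidalCategory D] {ι : 𝒞 ⥤ D} [ι.Monoidal]

namespace RightComod

/-- Simple objects of `𝒞` act invertibly on the category of right comodules. -/
theorem exists_tensorFunctor_comp_iso (h𝒞 : IsSemisimplePointedTensorCategory k 𝒞) (ι : 𝒞 ⥤ D)
    [ι.Monoidal] {T : 𝒞} (hT : Simple T) (C : D) [ComonObj C] :
    ∃ U : 𝒞,
      Nonempty (tensorFunctor C (ι.obj T) ⋙ tensorFunctor C (ι.obj U) ≅ 𝟭 (RightComod C)) ∧
      Nonempty (tensorFunctor C (ι.obj U) ⋙ tensorFunctor C (ι.obj T) ≅ 𝟭 (RightComod C)) := by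
  obtain ⟨U, ⟨e⟩, ⟨e'⟩⟩ := h𝒞.invertible T hT
  exact ⟨U,
    ⟨tensorCancel
      (Functor.Monoidal.μIso ι U T ≪≫ ι.mapIso e' ≪≫ (Functor.Monoidal.εIso ι).symm)⟩,
    ⟨tensorCancel
      (Functor.Monoidal.μIso ι T U ≪≫ ι.mapIso e ≪≫ (Functor.Monoidal.εIso ι).symm)⟩⟩

theorem isEquivalence_tensorFunctor (h𝒞 : IsSemisimplePointedTensorCategory k 𝒞) (ι : 𝒞 ⥤ D)
    [ι.Monoidal] {T : 𝒞} (hT : Simple T) (C : D) [ComonObj C] :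
    (tensorFunctor C (ι.obj T)).IsEquivalence := by
  obtain ⟨U, ⟨e⟩, ⟨e'⟩⟩ := exists_tensorFunctor_comp_iso h𝒞 ι hT C
  exact (CategoryTheory.Equivalence.mk (tensorFunctor C (ι.obj T)) (tensorFunctor C (ι.obj U))
    e.symm e').isEquivalence_functor

variable {C : D} [ComonObj C]

theorem simple_tensor [Preadditive D] [MonoidalPreadditive D]
    (h𝒞 : IsSemisimplePointedTensorCategory k 𝒞) {T : 𝒞} (hT : Simple T)
    {L : RightComod C} (hL : Simple L) : Simple (L.tensor (ι.obj T)) := by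
  have := isEquivalence_tensorFunctor h𝒞 ι hT C
  exact (tensorFunctor C (ι.obj T)).asEquivalence.simple_functor_obj hL

end RightComod

variable [Abelian D] [Linear k D] [MonoidalPreadditive D] [ι.Additive] [ι.Linear k]
  {C : D} [ComonObj C]

namespace RightComod

/-- Tensoring an injective comodule with an object with enough duals gives an injective
comodule. -/
theorem injective_tensor (h𝒞 : IsSemisimplePointedTensorCategory k 𝒞)
    (hι : IsTensorCocompletion ι) (F : 𝒞) {I : RightComod C} (hI : Injective I) :
    Injective (I.tensor (ι.obj F)) := by
  let : ExactPairing (ι.obj F) (ι.obj Fᘁ) := mapExactPairing ι F Fᘁ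
  let : ExactPairing (ι.obj Fᘁ) (ι.obj Fᘁᘁ) := mapExactPairing ι Fᘁ Fᘁᘁ
  refine ⟨fun {V W} g f _ => ?_⟩
  have := mono_hom h𝒞 hι f
  -- `F^* ⊗ -` is left adjoint to `F ⊗ -` on comodules; being itself right adjoint to `F^** ⊗ -` on
  -- `D`, it preserves monomorphisms, so `F ⊗ -` preserves injectives.
  have : (tensorLeft (ι.obj Fᘁ)).IsRightAdjoint :=
    (tensorLeftAdjunction (ι.obj Fᘁ) (ι.obj Fᘁᘁ)).isRightAdjoint
  have hm : Mono ((tensorLeft (ι.obj Fᘁ)).map f.hom) := inferInstance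
  have : Mono (tensorHomRight (ι.obj Fᘁ) f).hom := hm
  have := mono_of_mono_hom (tensorHomRight (ι.obj Fᘁ) f)
  refine ⟨transpose (ι.obj F) (ι.obj Fᘁ)
    (Injective.factorThru (untranspose (ι.obj F) (ι.obj Fᘁ) g)
      (tensorHomRight (ι.obj Fᘁ) f)), ?_⟩
  rw [comp_transpose, Injective.comp_factorThru, transpose_untranspose]

/-- Simple comodules have underlying object in `𝒞`. -/
theorem exists_iso_of_simple (h𝒞 : IsSemisimplePointedTensorCategory k 𝒞)
    (hι : IsTensorCocompletion ι) {S : RightComod C} (hS : Simple S) :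
    ∃ N : FinComod ι C, Nonempty (N.toRightComod ≅ S) := by
  have h0 : 𝟙 S.X ≠ 0 := fun h => id_nonzero S (hom_ext h)
  obtain ⟨T, x, -, hx⟩ := hι.exists_simple_comp_ne_zero h𝒞 h0
  obtain ⟨N, y, f, hy, hf⟩ := S.exists_finComod h𝒞 hι x
  have := mono_of_mono_hom f
  have hf0 : f ≠ 0 := by
    rintro rfl
    rw [Category.comp_id, ← hy] at hx
    exact hx comp_zero
  have := isIso_of_mono_of_nonzero hf0
  exact ⟨N, ⟨asIso f⟩⟩

theorem mono_of_simple (h𝒞 : IsSemisimplePointedTensorCategory k 𝒞)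
    (hι : IsTensorCocompletion ι) {S V : RightComod C} (hS : Simple S) {f : S ⟶ V} (hf : f ≠ 0) :
    Mono f := by
  obtain ⟨N, ⟨e⟩⟩ := exists_iso_of_simple h𝒞 hι hS
  have hef : e.hom ≫ f ≠ 0 := fun h => hf (by rw [← cancel_epi e.hom, h, comp_zero])
  have := FinComod.mono_hom_of_simple h𝒞 hι (Simple.of_iso e) hef
  have := mono_of_mono_hom (e.hom ≫ f)
  rw [← e.inv_hom_id_assoc f]
  infer_instance

/-- Transposing `s` along the equivalence gives a morphism from a simple comodule to `I`; it is zero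
or mono, and the socle condition applies. -/
theorem IsInjectiveEnvelope.exists_factor_functor (h𝒞 : IsSemisimplePointedTensorCategory k 𝒞)
    (hι : IsTensorCocompletion ι) {L I : RightComod C} {j : L ⟶ I} (hj : IsInjectiveEnvelope j)
    (e : RightComod C ≌ RightComod C) {S : RightComod C} (hS : Simple S)
    (s : S ⟶ e.functor.obj I) : ∃ t : S ⟶ e.functor.obj L, t ≫ e.functor.map j = s := by
  have hS' := e.symm.simple_functor_obj hS
  let Φ := e.symm.toAdjunction.homEquiv S
  suffices ∃ t, t ≫ j = (Φ I).symm s by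
    obtain ⟨t, ht⟩ := this
    refine ⟨Φ L t, ?_⟩
    have := e.symm.toAdjunction.homEquiv_naturality_right t j
    rw [ht] at this
    exact this.symm.trans (Equiv.apply_symm_apply _ _)
  by_cases h : (Φ I).symm s = 0
  · exact ⟨0, by rw [h, zero_comp]⟩
  · exact hj.socle _ _ hS' (mono_of_simple h𝒞 hι hS' h)

/-- Simple subcomodules of `F ⊗ I` lie in `F ⊗ L`, for an injective envelope `L ⟶ I`. -/
theorem IsInjectiveEnvelope.exists_factor_tensor (h𝒞 : IsSemisimplePointedTensorCategory k 𝒞)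
    (hι : IsTensorCocompletion ι) {L I : RightComod C} {j : L ⟶ I} (hj : IsInjectiveEnvelope j)
    (F : 𝒞) {S : RightComod C} (hS : Simple S) (s : S ⟶ I.tensor (ι.obj F)) :
    ∃ t : S ⟶ L.tensor (ι.obj F), t ≫ tensorHomRight (ι.obj F) j = s := by
  obtain ⟨n, T, p, q, hT, h⟩ := h𝒞.exists_decomposition F
  -- Each summand `T i` of `F` is invertible and acts by a self-equivalence; the componentwise lifts
  -- are reassembled through `q i`.
  have key (i : Fin n) : ∃ t : S ⟶ L.tensor (ι.obj (T i)), t ≫ tensorHomRight (ι.obj (T i)) j =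
      s ≫ tensorHomLeft (ι.map (p i)) I := by
    have := isEquivalence_tensorFunctor h𝒞 ι (hT i) C
    exact hj.exists_factor_functor h𝒞 hι (tensorFunctor C (ι.obj (T i))).asEquivalence hS
      (s ≫ tensorHomLeft (ι.map (p i)) I)
  choose t ht using key
  refine ⟨sumHom Finset.univ fun i => t i ≫ tensorHomLeft (ι.map (q i)) L, ?_⟩
  have h' : ∑ i, ι.map (p i) ≫ ι.map (q i) = 𝟙 (ι.obj F) := by
    simp only [← ι.map_comp]
    rw [← ι.map_sum, h, ι.map_id]
  rw [sumHom_comp, ← Category.comp_id s, ← sumHom_tensorHomLeft h', comp_sumHom]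
  congr 1
  funext i
  rw [Category.assoc, ← tensorHomRight_comp_tensorHomLeft, reassoc_of% ht]

/-- Simple subcomodules of `F ⊗ L`, with `L` simple, are of the form `T ⊗ L`. -/
theorem exists_iso_tensor_of_simple (h𝒞 : IsSemisimplePointedTensorCategory k 𝒞)
    (hι : IsTensorCocompletion ι) {L S : RightComod C} (hL : Simple L) (hS : Simple S) {F : 𝒞}
    {t : S ⟶ L.tensor (ι.obj F)} (ht : t ≠ 0) :
    ∃ T : 𝒞, Simple T ∧ Nonempty (S ≅ L.tensor (ι.obj T)) := by
  obtain ⟨n, T, p, q, hT, h⟩ := h𝒞.exists_decomposition F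
  have : ∃ i, t ≫ tensorHomLeft (ι.map (p i)) L ≠ 0 := by
    by_contra! H
    apply ht
    have h' : ∑ i, ι.map (p i) ≫ ι.map (q i) = 𝟙 (ι.obj F) := by
      simp only [← ι.map_comp]
      rw [← ι.map_sum, h, ι.map_id]
    rw [← Category.comp_id t, ← sumHom_tensorHomLeft h', comp_sumHom]
    exact sumHom_eq_zero fun i _ => by rw [← Category.assoc, H, zero_comp]
  obtain ⟨i, hi⟩ := this
  have hLT := simple_tensor (ι := ι) h𝒞 (hT i) hL
  have := mono_of_simple h𝒞 hι hS hi
  have := isIso_of_mono_of_nonzero hi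
  exact ⟨T i, hT i, ⟨asIso (t ≫ tensorHomLeft (ι.map (p i)) L)⟩⟩

end RightComod

/-- A simple comodule occurs in `F ⊗ L a` for at most one of the representatives `L a`. -/
theorem IsOrbitRepresentatives.eq_of_ne_zero (h𝒞 : IsSemisimplePointedTensorCategory k 𝒞)
    (hι : IsTensorCocompletion ι) {A : Type w} {L : A → FinComod ι C}
    (hL : IsOrbitRepresentatives L) {S : RightComod C} (hS : Simple S) {a b : A} {F F' : 𝒞}
    {t : S ⟶ (L a).toRightComod.tensor (ι.obj F)} (ht : t ≠ 0)
    {t' : S ⟶ (L b).toRightComod.tensor (ι.obj F')} (ht' : t' ≠ 0) : a = b := by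
  obtain ⟨T, hT, ⟨f⟩⟩ := RightComod.exists_iso_tensor_of_simple h𝒞 hι (hL.simple a) hS ht
  -- Cancelling `T` in `T ⊗ L a ≅ S ⟶ F' ⊗ L b` gives a nonzero morphism `L a ⟶ (U ⊗ F') ⊗ L b`, so
  -- `L a` is a twist of `L b`.
  obtain ⟨U, ⟨g⟩, ⟨g'⟩⟩ := RightComod.exists_tensorFunctor_comp_iso h𝒞 ι hT C
  have hU := (CategoryTheory.Equivalence.mk _ _ g.symm g').isEquivalence_inverse
  let G : RightComod C ⥤ RightComod C := RightComod.tensorFunctor C (ι.obj U)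
  have hG : G.Faithful := hU.faithful
  let e : G.obj ((L b).toRightComod.tensor (ι.obj F')) ≅
      (L b).toRightComod.tensor (ι.obj (U ⊗ F')) :=
    (RightComod.tensorAssoc _ _ _).symm ≪≫
      RightComod.tensorIsoLeft (Functor.Monoidal.μIso ι U F') _
  let g₀ : (L a).toRightComod ≅ G.obj ((L a).toRightComod.tensor (ι.obj T)) := (g.app _).symm
  let x : (L a).toRightComod ⟶ (L b).toRightComod.tensor (ι.obj (U ⊗ F')) :=
    g₀.hom ≫ G.map (f.inv ≫ t') ≫ e.hom
  have hx : x ≠ 0 := fun h => ht' (by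
    have h1 : G.map (f.inv ≫ t') = G.map 0 := by
      rw [← cancel_mono e.hom, ← cancel_epi g₀.hom]
      refine h.trans ?_
      have : G.map (0 : (L a).toRightComod.tensor (ι.obj T) ⟶
          (L b).toRightComod.tensor (ι.obj F')) = 0 :=
        RightComod.hom_ext (MonoidalPreadditive.whiskerLeft_zero)
      rw [this, zero_comp, comp_zero]
    rw [← cancel_epi f.inv, G.map_injective h1, comp_zero])
  obtain ⟨T', hT', h⟩ := RightComod.exists_iso_tensor_of_simple h𝒞 hι (hL.simple b) (hL.simple a) hx
  exact hL.unique a b T' hT' h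

end

/-! ### Cofreeness of `C` and matrix coefficients -/

section

open scoped ComonObj

variable {D : Type u₂} [Category.{v₂} D] [MonoidalCategory D]

namespace RightComod

variable {C : D} [ComonObj C]

/-- `C` is the cofree comodule on the unit object. -/
@[simps]
def toRegular (V : RightComod C) (l : V.X ⟶ 𝟙_ D) : V ⟶ regular C where
  hom := V.coact ≫ l ▷ C ≫ (λ_ C).hom
  comm := by
    change V.coact ≫ (V.coact ≫ l ▷ C ≫ (λ_ C).hom) ▷ C = (V.coact ≫ l ▷ C ≫ (λ_ C).hom) ≫ Δ
    calc
      _ = (V.coact ≫ V.coact ▷ C ≫ (α_ _ _ _).hom) ≫ l ▷ (C ⊗ C) ≫ (λ_ (C ⊗ C)).hom := by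
        simp
      _ = V.coact ≫ (V.X ◁ Δ ≫ l ▷ (C ⊗ C)) ≫ (λ_ (C ⊗ C)).hom := by
        rw [V.coassoc]; simp
      _ = (V.coact ≫ l ▷ C ≫ (λ_ C).hom) ≫ Δ := by
        rw [whisker_exchange]; simp

theorem toRegular_hom_counit (V : RightComod C) (l : V.X ⟶ 𝟙_ D) :
    (V.toRegular l).hom ≫ (ε : C ⟶ 𝟙_ D) = l := by
  calc
    _ = (V.coact ≫ l ▷ C ≫ (λ_ C).hom) ≫ (ε : C ⟶ 𝟙_ D) := rfl
    _ = V.coact ≫ (l ▷ C ≫ (𝟙_ D) ◁ ε) ≫ (λ_ _).hom := by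
      rw [Category.assoc, Category.assoc, Category.assoc, leftUnitor_naturality]
    _ = (V.coact ≫ V.X ◁ ε) ≫ l ▷ 𝟙_ D ≫ (λ_ _).hom := by
      rw [← whisker_exchange]; simp
    _ = l := by rw [V.counit, unitors_equal]; simp

/-- Colinearity trades the coaction of `V` for `Δ`, which the counit law cancels. With
`toRegular_hom_counit` this is the cofreeness of `C`. -/
theorem eq_toRegular {V : RightComod C} (f : V ⟶ regular C) : f = V.toRegular (f.hom ≫ (ε : C ⟶ 𝟙_ D)) := by
  obtain ⟨f', hf⟩ : ∃ f' : V.X ⟶ C, f' = f.hom := ⟨_, rfl⟩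
  have h : V.coact ≫ f' ▷ C = f' ≫ Δ := by rw [hf]; exact f.comm
  have h' : V.coact ≫ (f' ≫ ε) ▷ C ≫ (λ_ C).hom = f' := by
    rw [comp_whiskerRight, Category.assoc, reassoc_of% h, ComonObj.counit_comul_assoc]
    simp
  rw [hf] at h'
  exact hom_ext h'.symm

theorem comp_toRegular {V W : RightComod C} (g : V ⟶ W) (l : W.X ⟶ 𝟙_ D) :
    g ≫ W.toRegular l = V.toRegular (g.hom ≫ l) := by
  refine hom_ext ?_
  have : g.hom ≫ W.coact ≫ l ▷ C ≫ (λ_ C).hom = V.coact ≫ (g.hom ≫ l) ▷ C ≫ (λ_ C).hom := by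
    rw [← reassoc_of% g.comm]; simp
  exact this

end RightComod

/-- Evaluating one leg of the left coaction on the dual. -/
theorem dualMate_evaluation {V C : D} (Y : D) [ExactPairing V Y] (a : V ⟶ V ⊗ C) :
    dualMate Y a ▷ V ≫ (α_ C Y V).hom ≫ C ◁ ε_ V Y ≫ (ρ_ C).hom =
      Y ◁ a ≫ (α_ Y V C).inv ≫ ε_ V Y ▷ C ≫ (λ_ C).hom := by
  simp only [dualMate]
  calc
    _ = 𝟙 _ ⊗≫ Y ◁ η_ V Y ▷ V ⊗≫ Y ◁ a ▷ (Y ⊗ V) ⊗≫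
        (ε_ V Y ▷ (C ⊗ Y ⊗ V) ≫ (𝟙_ D) ◁ (C ◁ ε_ V Y)) ⊗≫ 𝟙 _ := by monoidal
    _ = 𝟙 _ ⊗≫ Y ◁ η_ V Y ▷ V ⊗≫ Y ◁ (a ▷ (Y ⊗ V) ≫ (V ⊗ C) ◁ ε_ V Y) ⊗≫
        ε_ V Y ▷ C ⊗≫ 𝟙 _ := by rw [← whisker_exchange]; monoidal
    _ = 𝟙 _ ⊗≫ Y ◁ (η_ V Y ▷ V ⊗≫ V ◁ ε_ V Y) ⊗≫ Y ◁ a ⊗≫ ε_ V Y ▷ C ⊗≫ 𝟙 _ := by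
      rw [← whisker_exchange]; monoidal
    _ = _ := by rw [ExactPairing.evaluation_coevaluation'']; monoidal

/-- `C` as a bicomodule over itself. -/
@[simps]
def Bicomod.regular (C : D) [ComonObj C] : Bicomod C where
  X := C
  coactL := Δ
  coactR := Δ
  coassocL := ComonObj.comul_assoc C
  counitL := ComonObj.counit_comul C
  coassocR := (ComonObj.comul_assoc C).symm
  counitR := ComonObj.comul_counit C
  comm := ComonObj.comul_assoc C

namespace RightComod

variable {C : D} [ComonObj C]

/-- The matrix coefficients of a comodule, as a morphism of right comodules. -/
def matrixCoeff (V : RightComod C) (Y : D) [ExactPairing V.X Y] : V.tensor Y ⟶ regular C :=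
  (V.tensor Y).toRegular (ε_ V.X Y)

theorem matrixCoeff_hom (V : RightComod C) (Y : D) [ExactPairing V.X Y] :
    (V.matrixCoeff Y).hom =
      (Y ◁ V.coact ≫ (α_ Y V.X C).inv) ≫ ε_ V.X Y ▷ C ≫ (λ_ C).hom := rfl

/-- The matrix coefficients of a comodule, as a morphism of bicomodules. -/
@[simps]
def matrixCoeffBicomod (V : RightComod C) (Y : D) [ExactPairing V.X Y] :
    boxTensor (V.dualOn Y) V ⟶ Bicomod.regular C where
  hom := (V.matrixCoeff Y).hom
  commR := (V.matrixCoeff Y).comm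
  commL := by
    let B := boxTensor (V.dualOn Y) V
    let φ : B.X ⟶ C := (V.matrixCoeff Y).hom
    let ev : B.X ⟶ 𝟙_ D := ε_ V.X Y
    have hφ : φ = B.coactR ≫ ev ▷ C ≫ (λ_ C).hom := matrixCoeff_hom V Y
    -- The same map arises from the left coaction of the dual followed by evaluation, so left
    -- colinearity reduces to the commutation of the two coactions.
    have hφ' : B.coactL ≫ C ◁ ev ≫ (ρ_ C).hom = φ := by
      have h := dualMate_evaluation Y V.coact
      rw [← Category.assoc (Y ◁ V.coact), ← matrixCoeff_hom] at h
      refine Eq.trans ?_ h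
      exact Category.assoc _ _ _
    have hR : B.coactR ≫ φ ▷ C = φ ≫ Δ := (V.matrixCoeff Y).comm
    change B.coactL ≫ C ◁ φ = φ ≫ Δ
    calc
      _ = (B.coactL ≫ C ◁ B.coactR) ≫ C ◁ ev ▷ C ≫ C ◁ (λ_ C).hom := by rw [hφ]; simp
      _ = B.coactR ≫ (B.coactL ≫ C ◁ ev ≫ (ρ_ C).hom) ▷ C := by rw [B.comm]; simp
      _ = _ := by rw [hφ', hR]

/-- Morphisms `T ⊗ V ⟶ C` are matrix coefficients. -/
theorem exists_tensorHomLeft_comp_matrixCoeff (V : RightComod C) (Y : D) [ExactPairing V.X Y]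
    {T : D} (f : V.tensor T ⟶ regular C) :
    ∃ t : T ⟶ Y, tensorHomLeft t V ≫ V.matrixCoeff Y = f := by
  let l : T ⊗ V.X ⟶ 𝟙_ D := f.hom ≫ (ε : C ⟶ 𝟙_ D)
  -- The transpose of the functional `l`; by cofreeness only functionals need to be compared.
  refine ⟨tensorRightHomEquiv T V.X Y (𝟙_ D) l ≫ (λ_ Y).hom, ?_⟩
  refine (comp_toRegular _ _).trans (Eq.trans ?_ (eq_toRegular f).symm)
  refine congrArg (toRegular _) ?_
  change (tensorRightHomEquiv T V.X Y (𝟙_ D) l ≫ (λ_ Y).hom) ▷ V.X ≫ ε_ V.X Y = l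
  conv_rhs => rw [← (tensorRightHomEquiv T V.X Y (𝟙_ D)).symm_apply_apply l]
  generalize tensorRightHomEquiv T V.X Y (𝟙_ D) l = m
  change _ = m ▷ V.X ≫ (α_ _ _ _).hom ≫ (𝟙_ D) ◁ ε_ V.X Y ≫ (ρ_ _).hom
  rw [← unitors_equal]
  simp

end RightComod

end

section

open scoped ComonObj

variable {k : Type*} [Field k] {𝒞 : Type u₁} [Category.{v₁} 𝒞] [Abelian 𝒞] [Linear k 𝒞]
  [MonoidalCategory 𝒞] [MonoidalPreadditive 𝒞] [MonoidalLinear k 𝒞] [RigidCategory 𝒞]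
  {D : Type u₂} [Category.{v₂} D] [Abelian D] [Linear k D] [MonoidalCategory D]
  [MonoidalPreadditive D] {ι : 𝒞 ⥤ D} [ι.Monoidal] [ι.Additive] [ι.Linear k]
  {C : D} [ComonObj C]

namespace FinComod

/-- The morphism `V^* ⊗ V ⟶ C` of right comodules given by the matrix coefficients of `V`. -/
def coeff (V : FinComod ι C) : V.toRightComod.tensor (ι.obj (V.X)ᘁ) ⟶ RightComod.regular C :=
  letI : ExactPairing V.toRightComod.X (ι.obj (V.X)ᘁ) := mapExactPairing ι V.X (V.X)ᘁ
  V.toRightComod.matrixCoeff (ι.obj (V.X)ᘁ)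

/-- The source is a simple bicomodule by (C2), so it is enough that the map is nonzero. Composed
with the counit it becomes evaluation, which cannot vanish by the zig-zag identity since `L` is
nonzero. -/
theorem mono_coeff_hom (h𝒞 : IsSemisimplePointedTensorCategory k 𝒞)
    (hι : IsTensorCocompletion ι) (hC2 : ConditionC2 ι C) {L : FinComod ι C}
    (hL : Simple L.toRightComod) : Mono L.coeff.hom := by
  let : ExactPairing L.toRightComod.X (ι.obj (L.X)ᘁ) := mapExactPairing ι L.X (L.X)ᘁ
  have hB : Simple (boxTensor (L.toRightComod.dualOn (ι.obj (L.X)ᘁ)) L.toRightComod) :=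
    hC2.simple L L hL hL
  have h0 : L.toRightComod.matrixCoeffBicomod (ι.obj (L.X)ᘁ) ≠ 0 := fun h => by
    have h1 : (L.toRightComod.matrixCoeff (ι.obj (L.X)ᘁ)).hom = 0 := congrArg Bicomod.Hom.hom h
    have h2 : ε_ L.toRightComod.X (ι.obj (L.X)ᘁ) = 0 :=
      (RightComod.toRegular_hom_counit _ _).symm.trans
        ((congrArg (· ≫ (ε : C ⟶ 𝟙_ D)) h1).trans zero_comp)
    have h3 := ExactPairing.evaluation_coevaluation L.toRightComod.X (ι.obj (L.X)ᘁ)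
    rw [h2, MonoidalPreadditive.whiskerLeft_zero, comp_zero, comp_zero] at h3
    refine id_nonzero L.toRightComod (RightComod.hom_ext ?_)
    change 𝟙 L.toRightComod.X = 0
    rw [← cancel_epi (λ_ L.toRightComod.X).hom, ← cancel_mono (ρ_ L.toRightComod.X).inv,
      Category.comp_id, ← h3, comp_zero, zero_comp]
  exact Bicomod.mono_hom_of_simple h𝒞 hι hB (Functor.Monoidal.μIso ι (L.X)ᘁ L.X).symm h0

/-- The matrix coefficients extend along monomorphisms of comodules. -/
theorem exists_extension_coeff (h𝒞 : IsSemisimplePointedTensorCategory k 𝒞)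
    (hι : IsTensorCocompletion ι) (L : FinComod ι C) {I : RightComod C} (j : L.toRightComod ⟶ I)
    [Mono j] : ∃ ψ : I.tensor (ι.obj (L.X)ᘁ) ⟶ RightComod.regular C,
      RightComod.tensorHomRight (ι.obj (L.X)ᘁ) j ≫ ψ = L.coeff := by
  let : ExactPairing L.toRightComod.X (ι.obj (L.X)ᘁ) := mapExactPairing ι L.X (L.X)ᘁ
  have hm : Mono (X := ι.obj L.X) j.hom := RightComod.mono_hom h𝒞 hι j
  obtain ⟨r, hr⟩ := hι.exists_retraction h𝒞 (F := L.X) j.hom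
  let r' : I.X ⟶ L.toRightComod.X := r
  have hr' : j.hom ≫ r' = 𝟙 L.toRightComod.X := hr
  -- The retraction `r'` lives in `D` and need not be colinear: it only extends the functional, and
  -- `toRegular` restores colinearity.
  refine ⟨(I.tensor _).toRegular (ι.obj (L.X)ᘁ ◁ r' ≫ ε_ L.toRightComod.X (ι.obj (L.X)ᘁ)), ?_⟩
  rw [RightComod.comp_toRegular]
  refine congrArg (RightComod.toRegular _) ?_
  change ι.obj (L.X)ᘁ ◁ j.hom ≫ ι.obj (L.X)ᘁ ◁ r' ≫ _ = _
  rw [← MonoidalCategory.whiskerLeft_comp_assoc, hr', MonoidalCategory.whiskerLeft_id,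
    Category.id_comp]

end FinComod

/-- The socle of `C` is generated by the matrix coefficients of the representatives. -/
theorem IsOrbitRepresentatives.exists_factor_coeff (h𝒞 : IsSemisimplePointedTensorCategory k 𝒞)
    (hι : IsTensorCocompletion ι) {A : Type w} {L : A → FinComod ι C}
    (hL : IsOrbitRepresentatives L) {S : RightComod C} (hS : Simple S)
    (f : S ⟶ RightComod.regular C) :
    ∃ (a : A) (t : S ⟶ (L a).toRightComod.tensor (ι.obj ((L a).X)ᘁ)), t ≫ (L a).coeff = f := by
  obtain ⟨N, ⟨e⟩⟩ := RightComod.exists_iso_of_simple h𝒞 hι hS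
  obtain ⟨a, T, -, ⟨e'⟩⟩ := hL.exists_iso N (Simple.of_iso e)
  let : ExactPairing (L a).toRightComod.X (ι.obj ((L a).X)ᘁ) := mapExactPairing ι (L a).X ((L a).X)ᘁ
  obtain ⟨t, ht⟩ := (L a).toRightComod.exists_tensorHomLeft_comp_matrixCoeff (ι.obj ((L a).X)ᘁ)
    (e'.inv ≫ e.hom ≫ f)
  refine ⟨a, e.inv ≫ e'.hom ≫ RightComod.tensorHomLeft t _, ?_⟩
  rw [Category.assoc, Category.assoc]
  change e.inv ≫ e'.hom ≫ _ ≫ (L a).toRightComod.matrixCoeff _ = f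
  rw [ht]
  simp

end

/-! ### Finite direct sums and differences of comodule morphisms -/

theorem biproduct_desc_eq_sum {D : Type u₂} [Category.{v₂} D] [Preadditive D] {J : Type w}
    [Fintype J] {X : J → D} [HasBiproduct X] {Y : D} (g : ∀ i, X i ⟶ Y) :
    biproduct.desc g = ∑ i, biproduct.π X i ≫ g i := by
  classical
  refine biproduct.hom_ext' _ _ fun i => ?_
  rw [biproduct.ι_desc, Preadditive.comp_sum, Finset.sum_eq_single i]
  · rw [biproduct.ι_π_self_assoc]
  · intro b _ hb
    rw [biproduct.ι_π_ne_assoc _ hb.symm, zero_comp]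
  · simp

namespace RightComod

open scoped ComonObj

variable {D : Type u₂} [Category.{v₂} D] [Preadditive D] [HasFiniteBiproducts D]
  [MonoidalCategory D] [MonoidalPreadditive D] {C : D} [ComonObj C] {J : Type w} [Finite J]

/-- Finite direct sums of comodules. -/
@[simps]
noncomputable def directSum (V : J → RightComod C) : RightComod C where
  X := ⨁ fun i => (V i).X
  coact := biproduct.desc fun i => (V i).coact ≫ biproduct.ι (fun i => (V i).X) i ▷ C
  coassoc := by
    refine biproduct.hom_ext' _ _ fun i => ?_
    rw [biproduct.ι_desc_assoc, biproduct.ι_desc_assoc, Category.assoc, Category.assoc,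
      ← comp_whiskerRight_assoc, biproduct.ι_desc, ← whisker_exchange, ← reassoc_of% (V i).coassoc]
    simp
  counit := by
    refine biproduct.hom_ext' _ _ fun i => ?_
    rw [biproduct.ι_desc_assoc, Category.assoc, ← whisker_exchange, reassoc_of% (V i).counit]
    simp

/-- Projections from finite direct sums of comodules. -/
noncomputable def directSumπ (V : J → RightComod C) (i : J) : directSum V ⟶ V i where
  hom := biproduct.π (fun i => (V i).X) i
  comm := by
    have : (biproduct.desc fun i => (V i).coact ≫ biproduct.ι (fun i => (V i).X) i ▷ C) ≫
        biproduct.π (fun i => (V i).X) i ▷ C = biproduct.π (fun i => (V i).X) i ≫ (V i).coact := by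
      refine biproduct.hom_ext' _ _ fun i' => ?_
      rw [biproduct.ι_desc_assoc, Category.assoc, ← comp_whiskerRight]
      by_cases h : i' = i
      · subst h
        rw [biproduct.ι_π_self, biproduct.ι_π_self_assoc, id_whiskerRight, Category.comp_id]
      · rw [biproduct.ι_π_ne _ h, biproduct.ι_π_ne_assoc _ h]; simp
    exact this

/-- Morphisms from finite direct sums of comodules. -/
noncomputable def directSumDesc (V : J → RightComod C) {W : RightComod C} (f : ∀ i, V i ⟶ W) :
    directSum V ⟶ W where
  hom := biproduct.desc fun i => (f i).hom
  comm := by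
    have : (biproduct.desc fun i => (V i).coact ≫ biproduct.ι (fun i => (V i).X) i ▷ C) ≫
        (biproduct.desc fun i => (f i).hom) ▷ C =
          (biproduct.desc fun i => (f i).hom) ≫ W.coact := by
      refine biproduct.hom_ext' _ _ fun i => ?_
      rw [biproduct.ι_desc_assoc, biproduct.ι_desc_assoc, Category.assoc, ← comp_whiskerRight,
        biproduct.ι_desc, (f i).comm]
    exact this

/-- The difference of two morphisms of comodules. -/
@[simps]
def subHom {V W : RightComod C} (f g : V ⟶ W) : V ⟶ W where
  hom := f.hom - g.hom
  comm := by
    have : (f.hom - g.hom) ▷ C = f.hom ▷ C - g.hom ▷ C := by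
      rw [eq_sub_iff_add_eq, ← MonoidalPreadditive.add_whiskerRight, sub_add_cancel]
    rw [this, Preadditive.comp_sub, Preadditive.sub_comp, f.comm, g.comm]

end RightComod

/-- The morphisms into `Y` which are sums of morphisms factoring through the members of a family
of morphisms with target `Y`. -/
def factorSubgroup {D : Type u₂} [Category.{v₂} D] [Preadditive D] {A : Type w} {X : A → D} {Y : D}
    (ψ : ∀ a, X a ⟶ Y) (Z : D) : AddSubgroup (Z ⟶ Y) :=
  AddSubgroup.closure {x | ∃ (a : A) (u : Z ⟶ X a), u ≫ ψ a = x}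

theorem comp_mem_factorSubgroup {D : Type u₂} [Category.{v₂} D] [Preadditive D] {A : Type w}
    {X : A → D} {Y : D} {ψ : ∀ a, X a ⟶ Y} {Z Z' : D} (g : Z' ⟶ Z) {x : Z ⟶ Y}
    (hx : x ∈ factorSubgroup ψ Z) : g ≫ x ∈ factorSubgroup ψ Z' := by
  have : factorSubgroup ψ Z ≤ (factorSubgroup ψ Z').comap (Preadditive.leftComp Y g) := by
    refine (AddSubgroup.closure_le _).2 ?_
    rintro _ ⟨a, u, rfl⟩
    exact AddSubgroup.subset_closure ⟨a, g ≫ u, Category.assoc _ _ _⟩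
  exact this hx

/-! ### `C` as the coproduct of the `L^* ⊗ I(L)` -/

section

open scoped ComonObj

variable {k : Type*} [Field k] {𝒞 : Type u₁} [Category.{v₁} 𝒞] [Abelian 𝒞] [Linear k 𝒞]
  [MonoidalCategory 𝒞] [MonoidalPreadditive 𝒞] [MonoidalLinear k 𝒞] [RigidCategory 𝒞]
  {D : Type u₂} [Category.{v₂} D] [Abelian D] [Linear k D] [MonoidalCategory D]
  [MonoidalPreadditive D] {ι : 𝒞 ⥤ D} [ι.Monoidal] [ι.Additive] [ι.Linear k]
  {C : D} [ComonObj C] {A : Type w} {L : A → FinComod ι C} {I : A → RightComod C}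
  {j : ∀ a, (L a).toRightComod ⟶ I a}
  {ψ : ∀ a, (I a).tensor (ι.obj ((L a).X)ᘁ) ⟶ RightComod.regular C}

theorem FinComod.mem_factorSubgroup (h𝒞 : IsSemisimplePointedTensorCategory k 𝒞)
    (hι : IsTensorCocompletion ι) (hL : IsOrbitRepresentatives L)
    (hI : ∀ a, RightComod.IsInjectiveEnvelope (j a))
    (hψ : ∀ a, RightComod.tensorHomRight (ι.obj ((L a).X)ᘁ) (j a) ≫ ψ a = (L a).coeff)
    (N : FinComod ι C) (f : N.toRightComod ⟶ RightComod.regular C) :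
    f.hom ∈ factorSubgroup (fun a => (ψ a).hom) N.toRightComod.X := by
  induction hn : endDim k N.X using Nat.strong_induction_on generalizing N with
  | h n ih =>
    subst hn
    -- A morphism with nonzero kernel factors through its image, which has smaller `endDim`, so
    -- induction applies.
    have small (f' : N.toRightComod ⟶ RightComod.regular C) (hf' : ¬ Mono f'.hom) :
        f'.hom ∈ factorSubgroup (fun a => (ψ a).hom) N.toRightComod.X := by
      obtain ⟨W, -, q, w, -, hqw, -, -, -, -, -, hdim⟩ := N.exists_kernel_image h𝒞 hι f'
      rw [← hqw]
      exact comp_mem_factorSubgroup q.hom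
        (ih _ (lt_of_not_ge fun h => hf' (hdim h)) W w rfl)
    by_cases h0 : 𝟙 N.toRightComod.X = 0
    · rw [← Category.id_comp f.hom, h0, zero_comp]
      exact zero_mem _
    · obtain ⟨S, s, hS, hs⟩ := N.exists_simple h𝒞 hι h0
      obtain ⟨a, t, ht⟩ := hL.exists_factor_coeff h𝒞 hι hS (s ≫ f)
      have := RightComod.injective_tensor h𝒞 hι ((L a).X)ᘁ (hI a).injective
      have := RightComod.mono_of_mono_hom s
      -- `g ≫ ψ a` agrees with `f` on `S`, so the difference kills `S` and is not mono.
      let g := Injective.factorThru (t ≫ RightComod.tensorHomRight (ι.obj ((L a).X)ᘁ) (j a)) s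
      have hg : s ≫ g ≫ ψ a = s ≫ f := by
        rw [Injective.comp_factorThru_assoc, Category.assoc, hψ, ht]
      have hsub : ¬ Mono (RightComod.subHom f (g ≫ ψ a)).hom := fun hm => by
        have := RightComod.mono_of_mono_hom (RightComod.subHom f (g ≫ ψ a))
        have hs0 : s ≫ RightComod.subHom f (g ≫ ψ a) = 0 := RightComod.hom_ext (by
          have h1 := congrArg RightComod.Hom.hom hg
          rw [RightComod.comp_hom, RightComod.comp_hom s f] at h1
          rw [RightComod.comp_hom, RightComod.subHom_hom, Preadditive.comp_sub, h1, sub_self]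
          rfl)
        have hs1 : s = 0 := by
          rw [← cancel_mono (RightComod.subHom f (g ≫ ψ a)), hs0, zero_comp]
        have h2 : 𝟙 S.toRightComod = 0 := by rw [← cancel_mono s, hs1, comp_zero, comp_zero]
        exact absurd h2 (id_nonzero _)
      have := add_mem (small _ hsub)
        (AddSubgroup.subset_closure ⟨a, g.hom, rfl⟩ :
          g.hom ≫ (ψ a).hom ∈ factorSubgroup (fun a => (ψ a).hom) N.toRightComod.X)
      rwa [RightComod.subHom_hom, RightComod.comp_hom, sub_add_cancel] at this

/-- Each component of a simple `S` in the kernel lands in `(L a)^* ⊗ L a` by the socle condition. At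
most one component is nonzero, as distinct representatives share no simple constituent, and that one
is detected by the mono `coeff`. -/
theorem mono_directSumDesc (h𝒞 : IsSemisimplePointedTensorCategory k 𝒞)
    (hι : IsTensorCocompletion ι) (hC2 : ConditionC2 ι C) (hL : IsOrbitRepresentatives L)
    (hI : ∀ a, RightComod.IsInjectiveEnvelope (j a))
    (hψ : ∀ a, RightComod.tensorHomRight (ι.obj ((L a).X)ᘁ) (j a) ≫ ψ a = (L a).coeff)
    [HasFiniteBiproducts D] (F : Finset A) :
    Mono (RightComod.directSumDesc (fun a : F => (I a).tensor (ι.obj ((L a).X)ᘁ))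
      (fun a => ψ a)).hom := by
  refine RightComod.mono_hom_of_simple_finComod h𝒞 hι _ fun S s hS hs => ?_
  have key (a : F) := (hI a).exists_factor_tensor h𝒞 hι ((L a).X)ᘁ hS
    (s ≫ RightComod.directSumπ (fun a : F => (I a).tensor (ι.obj ((L a).X)ᘁ)) a)
  choose t ht using key
  have hsum : ∑ a : F, (t a).hom ≫ (L a).coeff.hom = 0 := by
    refine Eq.trans ?_ (congrArg RightComod.Hom.hom hs)
    obtain ⟨s', hs'⟩ : ∃ s' : S.toRightComod.X ⟶ ⨁ fun a : F => ((I a).tensor (ι.obj ((L a).X)ᘁ)).X,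
      s' = s.hom := ⟨_, rfl⟩
    have h1 (a : F) : (t a).hom ≫ (L a).coeff.hom = s' ≫ biproduct.π _ a ≫ (ψ a).hom := by
      have : t a ≫ (L a).coeff = s ≫ RightComod.directSumπ _ a ≫ ψ a := by
        rw [← hψ, reassoc_of% ht]
      rw [hs']
      exact congrArg RightComod.Hom.hom this
    simp only [h1]
    rw [← Preadditive.comp_sum]
    refine Eq.trans (congrArg (s' ≫ ·) (biproduct_desc_eq_sum fun a : F => (ψ a).hom).symm) ?_
    rw [hs']
    rfl
  have ht0 (a : F) : t a = 0 := by
    by_contra ha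
    have hb (b : F) (hba : b ≠ a) : t b = 0 := by
      by_contra hb
      exact hba (Subtype.ext (hL.eq_of_ne_zero h𝒞 hι hS hb ha))
    rw [Finset.sum_eq_single a (fun b _ hba => by rw [hb b hba]; exact zero_comp) (by simp)] at hsum
    have := FinComod.mono_coeff_hom h𝒞 hι hC2 (hL.simple a)
    exact ha (RightComod.hom_ext ((cancel_mono (L a).coeff.hom).1 (hsum.trans zero_comp.symm)))
  refine RightComod.hom_ext (biproduct.hom_ext _ _ fun a => ?_)
  have h := congrArg RightComod.Hom.hom (ht a)
  rw [ht0, zero_comp] at h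
  exact h.symm.trans zero_comp.symm

/-- `C` is the coproduct of the comodules `L^* ⊗ I(L)`. -/
theorem nonempty_isColimit_cofan (h𝒞 : IsSemisimplePointedTensorCategory k 𝒞)
    (hι : IsTensorCocompletion ι) (hC2 : ConditionC2 ι C) (hL : IsOrbitRepresentatives L)
    (hI : ∀ a, RightComod.IsInjectiveEnvelope (j a))
    (hψ : ∀ a, RightComod.tensorHomRight (ι.obj ((L a).X)ᘁ) (j a) ≫ ψ a = (L a).coeff) :
    Nonempty (IsColimit (Cofan.mk (RightComod.regular C) ψ)) := by
  classical
  have := Abelian.hasFiniteBiproducts (C := D)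
  let U (a : A) : D := ((I a).tensor (ι.obj ((L a).X)ᘁ)).X
  -- The map `⨁ Hom(T, U a) ⟶ Hom(T, Z)` induced by `h`, written with finitely supported families;
  -- the coproduct property follows from bijectivity of `σ ψ'` on objects of `𝒞`.
  let σ {Z : D} (h : ∀ a, U a ⟶ Z) (T : D) : (Π₀ a, (T ⟶ U a)) →+ (T ⟶ Z) :=
    DFinsupp.sumAddHom fun a => Preadditive.rightComp T (h a)
  let ψ' (a : A) : U a ⟶ C := (ψ a).hom
  have σ_single {Z : D} (h : ∀ a, U a ⟶ Z) (T : D) (a : A) (u : T ⟶ U a) :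
      σ h T (DFinsupp.single a u) = u ≫ h a := DFinsupp.sumAddHom_single _ _ _
  have σ_comp {Z Z' : D} (h : ∀ a, U a ⟶ Z) (f : Z ⟶ Z') (T : D) (v : Π₀ a, (T ⟶ U a)) :
      σ h T v ≫ f = σ (fun a => h a ≫ f) T v := by
    have : (Preadditive.rightComp T f).comp (σ h T) = σ (fun a => h a ≫ f) T :=
      DFinsupp.addHom_ext fun a u => by
        rw [AddMonoidHom.comp_apply, σ_single, σ_single]
        exact Category.assoc _ _ _
    exact DFunLike.congr_fun this v
  have σ_precomp {T T' : D} (g : T' ⟶ T) (v : Π₀ a, (T ⟶ U a)) : ∃ v' : Π₀ a, (T' ⟶ U a),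
      ∀ (Z : D) (h : ∀ a, U a ⟶ Z), σ h T' v' = g ≫ σ h T v := by
    refine ⟨DFinsupp.mapRange.addMonoidHom (fun a => Preadditive.leftComp (U a) g) v, fun Z h => ?_⟩
    have : (σ h T').comp (DFinsupp.mapRange.addMonoidHom fun a => Preadditive.leftComp (U a) g) =
        (Preadditive.leftComp Z g).comp (σ h T) :=
      DFinsupp.addHom_ext fun a u => by
        rw [AddMonoidHom.comp_apply, AddMonoidHom.comp_apply, σ_single,
          DFinsupp.mapRange.addMonoidHom_apply, DFinsupp.mapRange_single, σ_single]
        exact Category.assoc _ _ _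
    exact DFunLike.congr_fun this v
  -- A finitely supported family is a morphism to the finite direct sum over its support.
  have inj (T : D) : Function.Injective (σ ψ' T) := by
    refine (injective_iff_map_eq_zero _).2 fun v hv => ?_
    have hm := mono_directSumDesc h𝒞 hι hC2 hL hI hψ v.support
    have hm' : Mono (biproduct.desc fun a : v.support => ψ' a) := hm
    have h0 : biproduct.lift (fun a : v.support => v a) = 0 := by
      rw [← cancel_mono (biproduct.desc fun a : v.support => ψ' a), 
        biproduct_desc_eq_sum, Preadditive.comp_sum, Preadditive.comp_sum]
      simp only [biproduct.lift_π_assoc, zero_comp, Finset.sum_const_zero]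
      rw [← hv]
      rw [DFinsupp.sumAddHom_apply, DFinsupp.sum, ← Finset.sum_coe_sort v.support]
      rfl
    ext a
    by_cases ha : a ∈ v.support
    · have := congrArg (· ≫ biproduct.π (fun a : v.support => U a) ⟨a, ha⟩) h0
      simpa using this
    · simpa using ha
  have surj (T : 𝒞) : Function.Surjective (σ ψ' (ι.obj T)) := fun x => by
    obtain ⟨N, y, f, rfl, -⟩ := (RightComod.regular C).exists_finComod h𝒞 hι x
    have h1 := comp_mem_factorSubgroup y (N.mem_factorSubgroup h𝒞 hι hL hI hψ f)
    have h2 : factorSubgroup ψ' (ι.obj T) ≤ (σ ψ' (ι.obj T)).range := by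
      refine (AddSubgroup.closure_le _).2 ?_
      rintro _ ⟨a, u, rfl⟩
      exact ⟨DFinsupp.single a u, σ_single _ _ _ _⟩
    exact h2 h1
  choose τ hτ using surj
  have exists_desc {Z : D} (h : ∀ a, U a ⟶ Z) : ∃ f : C ⟶ Z, ∀ a, ψ' a ≫ f = h a := by
    -- Decompose `x` by the inverse `τ` of `σ ψ'`, then recombine along `h`; injectivity of `σ ψ'`
    -- makes this natural in `T`.
    obtain ⟨f, hf⟩ := hι.exists_hom (X := C) (Z := Z) (fun T x => σ h _ (τ T x)) fun T T' u x => by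
      obtain ⟨v', hv'⟩ := σ_precomp (ι.map u) (τ T x)
      rw [← hv']
      congr 1
      exact inj _ (by rw [hτ, hv', hτ])
    refine ⟨f, fun a => hι.hom_ext fun T x => ?_⟩
    rw [← Category.assoc, hf, ← σ_single h]
    congr 1
    exact inj _ (by rw [hτ, σ_single])
  have desc_ext {Z : D} {f g : C ⟶ Z} (h : ∀ a, ψ' a ≫ f = ψ' a ≫ g) : f = g := by
    refine hι.hom_ext fun T x => ?_
    rw [← hτ T x, σ_comp, σ_comp]
    simp only [h]
  have exists_descHom (Z : RightComod C) (h : ∀ a, (I a).tensor (ι.obj ((L a).X)ᘁ) ⟶ Z) :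
      ∃ f : RightComod.regular C ⟶ Z, ∀ a, ψ a ≫ f = h a := by
    obtain ⟨f, hf⟩ := exists_desc fun a => (h a).hom
    -- The `ψ' a` are jointly epimorphic in `D`, so colinearity of `f` can be checked after each of
    -- them.
    refine ⟨⟨f, desc_ext fun a => ?_⟩, fun a => RightComod.hom_ext (hf a)⟩
    have h1 : ((I a).tensor (ι.obj ((L a).X)ᘁ)).coact ≫ ψ' a ▷ C = ψ' a ≫ Δ := (ψ a).comm
    have h2 := (h a).comm
    change ψ' a ≫ Δ ≫ f ▷ C = ψ' a ≫ f ≫ Z.coact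
    rw [← reassoc_of% h1, ← comp_whiskerRight, hf, reassoc_of% hf]
    exact h2
  choose d hd using exists_descHom
  exact ⟨Cofan.IsColimit.mk _ (fun s => d s.pt s.inj) (fun s a => hd _ _ a) fun s m hm =>
    RightComod.hom_ext (desc_ext fun a =>
      congrArg RightComod.Hom.hom ((hm a).trans (hd s.pt s.inj a).symm))⟩

end

theorem mainTheorem4 {k : Type*} [Field k]
    {𝒞 : Type u₁} [Category.{v₁} 𝒞] [Abelian 𝒞] [Linear k 𝒞] [MonoidalCategory 𝒞]
    [MonoidalPreadditive 𝒞] [MonoidalLinear k 𝒞] [RigidCategory 𝒞]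
    (h𝒞 : IsSemisimplePointedTensorCategory k 𝒞)
    {D : Type u₂} [Category.{v₂} D] [Abelian D] [Linear k D] [MonoidalCategory D]
    [MonoidalPreadditive D] [MonoidalLinear k D]
    (ι : 𝒞 ⥤ D) [ι.Monoidal] [ι.Additive] [ι.Linear k] (hι : IsTensorCocompletion ι)
    (C : D) [ComonObj C] (hC1 : ConditionC1 ι C) (hC2 : ConditionC2 ι C)
    {A : Type w} (L : A → FinComod ι C) (hL : IsOrbitRepresentatives L)
    (I : A → RightComod C) (j : ∀ a, (L a).toRightComod ⟶ I a)
    (hI : ∀ a, RightComod.IsInjectiveEnvelope (j a)) :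
    ∃ _ : HasCoproduct (fun a => (I a).tensor (ι.obj ((L a).X)ᘁ)),
      Nonempty (RightComod.regular C ≅ ∐ fun a => (I a).tensor (ι.obj ((L a).X)ᘁ)) := by
  have hψ (a : A) : ∃ ψ : (I a).tensor (ι.obj ((L a).X)ᘁ) ⟶ RightComod.regular C,
      RightComod.tensorHomRight (ι.obj ((L a).X)ᘁ) (j a) ≫ ψ = (L a).coeff := by
    have := (hI a).mono
    exact (L a).exists_extension_coeff h𝒞 hι (j a)
  choose ψ hψ using hψ
  obtain ⟨hc⟩ := nonempty_isColimit_cofan h𝒞 hι hC2 hL hI hψ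
  have : HasCoproduct (fun a => (I a).tensor (ι.obj ((L a).X)ᘁ)) := ⟨⟨⟨_, hc⟩⟩⟩
  exact ⟨this, ⟨hc.coconePointUniqueUpToIso (colimit.isColimit _)⟩⟩
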